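/- A *modular ortholattice* (MOL) is a bounded modular lattice with a unary operation $'$ such that $x+x'=1$, $x\cdot x'=0$, $x''=x$, and $x\le y$ implies $y'\le x'$ (joins are written $+$, meets $\cdot$). A *3-frame* in $L$ consists of elements $a_i,a_{ij}$ ($1\le i\neq j\le 3$) such that for all distinct $j,k,l$ $$a_j\sum_{i\ne j}a_i=\prod_i a_i=a_ja_{jk},\qquad a_j+a_{jk}=a_j+a_k,\qquad a_{jl}=a_{lj}=(a_j+a_l)(a_{jk}+a_{kl});$$ it is *orthogonal* if $a_j\le a_k'$ for all $j\ne k$. It *generates* $L$ if $L$ is its only sub-MOL (subset containing $0,1$ and closed under $+,\cdot,{}'$) containing the frame. The *height* of a lattice is the minimal length of its maximal chains, the length of a chain being its cardinality with one element deleted. An MOL is *subdirectly irreducible* if it has a least congruence among those different from equality. **Corollary.** There is a subdirectly irreducible MOL of infinite height that is generated by an orthogonal 3-frame. It is obtained as a sublattice of an ultraproduct, as follows. For $n\ge 1$ let $e_{(i,t)}$ ($1\le i\le 3$, $1\le t\le n$) be the standard basis of $\mathbb Q^{3n}$, and let the canonical 3-frame in the lattice of subspaces of $\mathbb Q^{3n}$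 consist of $E_i=\mathrm{span}\{e_{(i,t)}\mid t\le n\}$ and $E_{ij}=\mathrm{span}\{e_{(i,t)}-e_{(j,t)}\mid t\le n\}$. There are positive definite symmetric bilinear forms $\Phi_k$ on $\mathbb Q^{3\cdot 2^k}$ ($k\ge 0$) such that, for each $k$, the canonical 3-frame of $\mathbb Q^{3\cdot 2^k}$ is an orthogonal 3-frame generating the MOL $L_k$ of all subspaces of $\mathbb Q^{3\cdot 2^k}$ with the orthocomplementation induced by $\Phi_k$, and such that for every non-principal ultrafilter $U$ on $\mathbb N$ the ultraproduct $\prod_k L_k/U$ has a sub-MOL $S$ that is subdirectly irreducible, of infinite height, and generated by an orthogonal 3-frame, namely by the elements of the ultraproduct represented by the families of canonical frames. -/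

import Mathlib

/-- A modular ortholattice (MOL): a bounded modular lattice with an orthocomplementation. -/
class ModularOrtholattice (L : Type*) extends Lattice L, BoundedOrder L, Compl L where
  sup_compl : ∀ x : L, x ⊔ xᶜ = ⊤
  inf_compl : ∀ x : L, x ⊓ xᶜ = ⊥
  compl_compl' : ∀ x : L, xᶜᶜ = x
  compl_anti : ∀ x y : L, x ≤ y → yᶜ ≤ xᶜ
  sup_inf_le : ∀ x y z : L, x ≤ z → (x ⊔ y) ⊓ z ≤ x ⊔ y ⊓ z

instance ModularOrtholattice.isModularLattice (L : Type*) [ModularOrtholattice L] :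
    IsModularLattice L where
  sup_inf_le_assoc_of_le {x} y {z} h := ModularOrtholattice.sup_inf_le x y z h

/-- The height of a lattice: the minimal length of maximal chains, where the length of a chain is
its cardinality with one element deleted. -/
noncomputable def latticeHeight (L : Type*) [Lattice L] : ℕ∞ :=
  ⨅ c : {c : Set L // IsMaxChain (· ≤ ·) c}, (c.1.encard - 1)

/-- Congruence relations of a modular ortholattice. -/
structure MOLCon (L : Type*) [ModularOrtholattice L] extends LatticeCon L where
  compl : ∀ {x y : L}, r x y → r xᶜ yᶜ

/-- A congruence is nontrivial if it is not the equality relation. -/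
def MOLCon.IsNontrivial {L : Type*} [ModularOrtholattice L] (θ : MOLCon L) : Prop :=
  ∃ x y : L, x ≠ y ∧ θ.r x y

/-- Subdirect irreducibility: there is a least nontrivial congruence. -/
def IsSubdirectlyIrreducibleMOL (L : Type*) [ModularOrtholattice L] : Prop :=
  ∃ μ : MOLCon L, μ.IsNontrivial ∧
    ∀ θ : MOLCon L, θ.IsNontrivial → ∀ x y : L, μ.r x y → θ.r x y

/-- Subalgebras of a modular ortholattice. -/
structure SubMOL (L : Type*) [ModularOrtholattice L] where
  carrier : Set L
  bot_mem : ⊥ ∈ carrier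
  top_mem : ⊤ ∈ carrier
  sup_mem : ∀ {x y : L}, x ∈ carrier → y ∈ carrier → x ⊔ y ∈ carrier
  inf_mem : ∀ {x y : L}, x ∈ carrier → y ∈ carrier → x ⊓ y ∈ carrier
  compl_mem : ∀ {x : L}, x ∈ carrier → xᶜ ∈ carrier

namespace SubMOL

/-- The underlying type of a subalgebra. -/
abbrev Elem {L : Type*} [ModularOrtholattice L] (S : SubMOL L) : Type _ := {x : L // x ∈ S.carrier}

/-- A subalgebra is a modular ortholattice under the restricted order and operations. -/
instance {L : Type*} [ModularOrtholattice L] (S : SubMOL L) : ModularOrtholattice S.Elem where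
  toLattice := Subtype.lattice (fun _ _ => S.sup_mem) (fun _ _ => S.inf_mem)
  top := ⟨⊤, S.top_mem⟩
  bot := ⟨⊥, S.bot_mem⟩
  le_top _ := Subtype.mk_le_mk.2 le_top
  bot_le _ := Subtype.mk_le_mk.2 bot_le
  compl x := ⟨(x.1)ᶜ, S.compl_mem x.2⟩
  sup_compl x := Subtype.ext (ModularOrtholattice.sup_compl x.1)
  inf_compl x := Subtype.ext (ModularOrtholattice.inf_compl x.1)
  compl_compl' x := Subtype.ext (ModularOrtholattice.compl_compl' x.1)
  compl_anti x y h := ModularOrtholattice.compl_anti x.1 y.1 h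
  sup_inf_le x y z h := ModularOrtholattice.sup_inf_le x.1 y.1 z.1 h

/-- The subalgebra generated by a set: the intersection of all subalgebras containing it. -/
def closure {L : Type*} [ModularOrtholattice L] (s : Set L) : SubMOL L where
  carrier := {x | ∀ T : SubMOL L, s ⊆ T.carrier → x ∈ T.carrier}
  bot_mem := fun T _ => T.bot_mem
  top_mem := fun T _ => T.top_mem
  sup_mem hx hy T hT := T.sup_mem (hx T hT) (hy T hT)
  inf_mem hx hy T hT := T.inf_mem (hx T hT) (hy T hT)
  compl_mem hx T hT := T.compl_mem (hx T hT)

end SubMOL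

/-- A list of elements `a_i` and `a_ij` (`i ≠ j`) of `L`. The values `ax i i` play no role. -/
structure FrameData (n : ℕ) (L : Type*) where
  pt : Fin n → L
  ax : Fin n → Fin n → L

namespace FrameData

variable {n : ℕ} {L : Type*}

/-- Von Neumann's conditions for an `n`-frame. -/
def IsFrame [ModularOrtholattice L] (a : FrameData n L) : Prop :=
  ∀ j k l : Fin n, j ≠ k → k ≠ l → j ≠ l →
    a.pt j ⊓ (Finset.univ.erase j).sup a.pt = Finset.univ.inf a.pt ∧
    a.pt j ⊓ a.ax j k = Finset.univ.inf a.pt ∧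
    a.pt j ⊔ a.ax j k = a.pt j ⊔ a.pt k ∧
    a.ax j l = a.ax l j ∧
    a.ax j l = (a.pt j ⊔ a.pt l) ⊓ (a.ax j k ⊔ a.ax k l)

/-- The points of the frame are pairwise orthogonal. -/
def IsOrthogonal [ModularOrtholattice L] (a : FrameData n L) : Prop :=
  ∀ j k : Fin n, j ≠ k → a.pt j ≤ (a.pt k)ᶜ

/-- The set of elements occurring in the frame. -/
def elems (a : FrameData n L) : Set L :=
  {x | (∃ i, x = a.pt i) ∨ ∃ i j, i ≠ j ∧ x = a.ax i j}

/-- `L` is generated, as a modular ortholattice, by the frame. -/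
def Generates [ModularOrtholattice L] (a : FrameData n L) : Prop :=
  ∀ x : L, x ∈ (SubMOL.closure a.elems).carrier

/-- `L` is generated by the orthogonal `n`-frame `a`. -/
def IsGeneratingOrthogonalFrame [ModularOrtholattice L] (a : FrameData n L) : Prop :=
  a.IsFrame ∧ a.IsOrthogonal ∧ a.Generates

end FrameData

/-- Positive definite symmetric bilinear forms on the rational vector space `ℚ^ι`. -/
structure PosDefForm (ι : Type*) where
  form : LinearMap.BilinForm ℚ (ι → ℚ)
  symm : ∀ x y, form x y = form y x
  pos : ∀ x, x ≠ 0 → 0 < form x x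

/-- The lattice `𝓛(ℚ^ι)` of all linear subspaces, with the orthocomplementation induced by `Φ`. -/
def SubspaceMOL {ι : Type*} (_Φ : PosDefForm ι) : Type _ := Submodule ℚ (ι → ℚ)

theorem PosDefForm.inf_orthogonal {ι : Type*} (Φ : PosDefForm ι) (X : Submodule ℚ (ι → ℚ)) :
    X ⊓ Φ.form.orthogonal X = ⊥ := by
  rw [eq_bot_iff]
  rintro x ⟨hx, hx'⟩
  by_contra h
  exact (Φ.pos x h).ne' (hx' x hx)

theorem PosDefForm.isRefl {ι : Type*} (Φ : PosDefForm ι) : Φ.form.IsRefl := by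
  intro x y h
  rw [Φ.symm, h]

theorem PosDefForm.isCompl {ι : Type*} [Finite ι] (Φ : PosDefForm ι)
    (X : Submodule ℚ (ι → ℚ)) : IsCompl X (Φ.form.orthogonal X) :=
  (LinearMap.BilinForm.isCompl_orthogonal_iff_disjoint Φ.isRefl).2
    (disjoint_iff.2 (Φ.inf_orthogonal X))

theorem PosDefForm.orthogonal_orthogonal {ι : Type*} [Finite ι] (Φ : PosDefForm ι)
    (X : Submodule ℚ (ι → ℚ)) : Φ.form.orthogonal (Φ.form.orthogonal X) = X := by
  have h1 := LinearMap.BilinForm.le_orthogonal_orthogonal (N := X) Φ.isRefl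
  refine (eq_of_le_of_inf_le_of_sup_le (z := Φ.form.orthogonal X) h1 ?_ ?_).symm
  · rw [inf_comm, Φ.inf_orthogonal]
    exact bot_le
  · rw [(Φ.isCompl X).sup_eq_top]
    exact le_top

instance SubspaceMOL.instMOL {ι : Type*} [Finite ι] (Φ : PosDefForm ι) :
    ModularOrtholattice (SubspaceMOL Φ) where
  toLattice := inferInstanceAs (Lattice (Submodule ℚ (ι → ℚ)))
  toBoundedOrder := inferInstanceAs (BoundedOrder (Submodule ℚ (ι → ℚ)))
  compl X := Φ.form.orthogonal X
  sup_compl X := (Φ.isCompl X).sup_eq_top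
  inf_compl X := Φ.inf_orthogonal X
  compl_compl' X := Φ.orthogonal_orthogonal X
  compl_anti _ _ h := LinearMap.BilinForm.orthogonal_le h
  sup_inf_le _ _ _ h := IsModularLattice.sup_inf_le_assoc_of_le (α := Submodule ℚ (ι → ℚ)) _ h

/-- The (image of the) canonical 3-frame in `𝓛(ℚ^(3n))`: with the standard basis indexed by
`(i, t)`, `i < 3`, `t < n`, the element `E_i` is spanned by the `e_(i,t)`, and `E_ij` by
the `e_(i,t) - e_(j,t)`. -/
def canonicalFrame {n : ℕ} (Φ : PosDefForm (Fin 3 × Fin n)) : FrameData 3 (SubspaceMOL Φ) where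
  pt i := (Submodule.span ℚ (Set.range fun t : Fin n =>
    (Pi.single (i, t) 1 : Fin 3 × Fin n → ℚ)) : Submodule ℚ (Fin 3 × Fin n → ℚ))
  ax i j := (Submodule.span ℚ (Set.range fun t : Fin n =>
    (Pi.single (i, t) 1 - Pi.single (j, t) 1 : Fin 3 × Fin n → ℚ)) :
      Submodule ℚ (Fin 3 × Fin n → ℚ))

/-- The reduced product of a family of modular ortholattices modulo a filter (the ultraproduct,
if `F` is an ultrafilter) with the order and the operations induced from the factors. -/
instance Filter.Product.instMOL {κ : Type*} (F : Filter κ) (L : κ → Type*)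
    [∀ k, ModularOrtholattice (L k)] : ModularOrtholattice (F.Product L) where
  le := Quotient.lift₂ (fun x y => ∀ᶠ k in F, x k ≤ y k) fun x y x' y' hx hy => by
    refine propext (Filter.eventually_congr ?_)
    filter_upwards [hx, hy] with k h1 h2
    rw [h1, h2]
  le_refl := by
    rintro ⟨x⟩
    exact Filter.Eventually.of_forall fun k => le_refl (x k)
  le_trans := by
    rintro ⟨x⟩ ⟨y⟩ ⟨z⟩ h1 h2
    exact Filter.Eventually.mp h1 (h2.mono fun k h h' => le_trans h' h)
  le_antisymm := by
    rintro ⟨x⟩ ⟨y⟩ h1 h2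
    exact Quotient.sound (Filter.Eventually.mp h1 (h2.mono fun k h h' => le_antisymm h' h))
  sup := Quotient.map₂ (fun x y k => x k ⊔ y k) fun x x' hx y y' hy => by
    change ∀ᶠ k in F, x k ⊔ y k = x' k ⊔ y' k
    filter_upwards [hx, hy] with k h1 h2
    rw [h1, h2]
  inf := Quotient.map₂ (fun x y k => x k ⊓ y k) fun x x' hx y y' hy => by
    change ∀ᶠ k in F, x k ⊓ y k = x' k ⊓ y' k
    filter_upwards [hx, hy] with k h1 h2
    rw [h1, h2]
  le_sup_left := by
    rintro ⟨x⟩ ⟨y⟩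
    exact Filter.Eventually.of_forall fun k => (le_sup_left : x k ≤ x k ⊔ y k)
  le_sup_right := by
    rintro ⟨x⟩ ⟨y⟩
    exact Filter.Eventually.of_forall fun k => (le_sup_right : y k ≤ x k ⊔ y k)
  sup_le := by
    rintro ⟨x⟩ ⟨y⟩ ⟨z⟩ h1 h2
    exact Filter.Eventually.mp h1 (h2.mono fun k h h' => sup_le h' h)
  inf_le_left := by
    rintro ⟨x⟩ ⟨y⟩
    exact Filter.Eventually.of_forall fun k => (inf_le_left : x k ⊓ y k ≤ x k)
  inf_le_right := by
    rintro ⟨x⟩ ⟨y⟩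
    exact Filter.Eventually.of_forall fun k => (inf_le_right : x k ⊓ y k ≤ y k)
  le_inf := by
    rintro ⟨x⟩ ⟨y⟩ ⟨z⟩ h1 h2
    exact Filter.Eventually.mp h1 (h2.mono fun k h h' => le_inf h' h)
  top := Quotient.mk _ fun _ => ⊤
  bot := Quotient.mk _ fun _ => ⊥
  le_top := by
    rintro ⟨x⟩
    exact Filter.Eventually.of_forall fun k => (le_top : x k ≤ ⊤)
  bot_le := by
    rintro ⟨x⟩
    exact Filter.Eventually.of_forall fun k => (bot_le : ⊥ ≤ x k)
  compl := Quotient.map (fun x k => (x k)ᶜ) fun x x' hx => by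
    change ∀ᶠ k in F, (x k)ᶜ = (x' k)ᶜ
    filter_upwards [hx] with k h1
    rw [h1]
  sup_compl := by
    rintro ⟨x⟩
    exact Quotient.sound (Filter.Eventually.of_forall fun k => ModularOrtholattice.sup_compl (x k))
  inf_compl := by
    rintro ⟨x⟩
    exact Quotient.sound (Filter.Eventually.of_forall fun k => ModularOrtholattice.inf_compl (x k))
  compl_compl' := by
    rintro ⟨x⟩
    exact Quotient.sound
      (Filter.Eventually.of_forall fun k => ModularOrtholattice.compl_compl' (x k))
  compl_anti := by
    rintro ⟨x⟩ ⟨y⟩ h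
    exact Filter.Eventually.mono h fun k h => ModularOrtholattice.compl_anti (x k) (y k) h
  sup_inf_le := by
    rintro ⟨x⟩ ⟨y⟩ ⟨z⟩ h
    exact Filter.Eventually.mono h fun k h => ModularOrtholattice.sup_inf_le (x k) (y k) (z k) h

/-- The elements of a reduced product that correspond to a family of frames. -/
def FrameData.product {κ : Type*} (F : Filter κ) {L : κ → Type*} {n : ℕ}
    (a : ∀ k, FrameData n (L k)) : FrameData n (F.Product L) where
  pt i := Quotient.mk _ fun k => (a k).pt i
  ax i j := Quotient.mk _ fun k => (a k).ax i j

/-!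
The form `Φ k` is the orthogonal sum of three forms on `ℚ^n`, with Gram matrices `1`, the diagonal
matrix `D` of pairwise distinct positive numbers, and `1 + J` for the all-ones matrix `J`. The
orthocomplement of the graph of `1` from the first summand to the `i`-th one meets the sum of these
two summands in the graph of the negative of the `i`-th Gram matrix, so `D` and `J` belong to the
coordinate ring of the frame. As they generate the ring of all matrices over `ℚ`, the frame
generates all subspaces.

Let the entries of `D` tend to infinity with `k`. Then every element generated by the frame in the
ultraproduct agrees, up to finitely many vectors, with the values at `D` of a fixed subspace of
`ℚ(x)³`, since this class of families is closed under joins and orthocomplements: the form `Φ k`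
differs by rank one from a form that is diagonal over `ℚ(x)`. Such a family vanishes as soon as it
is orthogonal to all lines spanned by a vector `Dʲ(1, …, 1)` in one of the three summands. Hence
below every nonzero element there is a nonzero element of rank at most one, which gives infinite
height; and no such line is orthogonal to the line spanned by `(1, -1, -1)`, so the congruence that
collapses the latter is the least nontrivial one.
-/

section Ortholattice

variable {L : Type*} [ModularOrtholattice L]

namespace ModularOrtholattice

theorem le_compl_of_le_compl {x y : L} (h : x ≤ yᶜ) : y ≤ xᶜ := by
  simpa only [compl_compl'] using compl_anti _ _ h

theorem compl_bot' : (⊥ : L)ᶜ = ⊤ := by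
  simpa only [bot_sup_eq] using sup_compl (⊥ : L)

theorem compl_sup' (x y : L) : (x ⊔ y)ᶜ = xᶜ ⊓ yᶜ :=
  le_antisymm (le_inf (compl_anti _ _ le_sup_left) (compl_anti _ _ le_sup_right))
    (le_compl_of_le_compl
      (sup_le (le_compl_of_le_compl inf_le_left) (le_compl_of_le_compl inf_le_right)))

theorem compl_sup_compl (x y : L) : (xᶜ ⊔ yᶜ)ᶜ = x ⊓ y := by
  rw [compl_sup', compl_compl', compl_compl']

theorem compl_inf' (x y : L) : (x ⊓ y)ᶜ = xᶜ ⊔ yᶜ := by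
  rw [← compl_sup_compl, compl_compl']

theorem eq_of_le_of_inf_compl_eq_bot {x y : L} (h : x ≤ y) (h' : y ⊓ xᶜ = ⊥) : x = y := by
  refine h.antisymm ?_
  simpa only [sup_compl, top_inf_eq, inf_comm xᶜ, h', sup_bot_eq] using sup_inf_le x xᶜ y h

theorem sup_compl_inf_ne_bot {q z : L} (hq : q ≠ ⊥) (h : q ⊓ zᶜ = ⊥) : (q ⊔ zᶜ) ⊓ z ≠ ⊥ := by
  intro h0
  have hqz : q ≤ zᶜ := sup_eq_right.1
    (eq_of_le_of_inf_compl_eq_bot le_sup_right (by rwa [compl_compl'])).symm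
  exact hq (by rwa [inf_eq_left.2 hqz] at h)

end ModularOrtholattice

open ModularOrtholattice

theorem MOLCon.rel_bot_of_inf_compl_eq_bot (θ : MOLCon L) {q z : L} (hz : θ.r z ⊥)
    (h : q ⊓ zᶜ = ⊥) : θ.r q ⊥ := by
  simpa only [h, compl_bot', inf_top_eq] using θ.symm' (θ.inf (θ.refl' q) (θ.compl hz))

/-- The principal congruence generated by the pair `(p, ⊥)`, as the intersection of all congruences
containing that pair. -/
def MOLCon.collapse (p : L) : MOLCon L where
  r x y := ∀ θ : MOLCon L, θ.r p ⊥ → θ.r x y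
  iseqv := ⟨fun x θ _ => θ.refl' x, fun h θ hθ => θ.symm' (h θ hθ),
    fun h h' θ hθ => θ.trans' (h θ hθ) (h' θ hθ)⟩
  inf h h' θ hθ := θ.inf (h θ hθ) (h' θ hθ)
  sup h h' θ hθ := θ.sup (h θ hθ) (h' θ hθ)
  compl h θ hθ := θ.compl (h θ hθ)

theorem MOLCon.IsNontrivial.exists_rel_bot {θ : MOLCon L} (hθ : θ.IsNontrivial) :
    ∃ z, z ≠ ⊥ ∧ θ.r z ⊥ := by
  obtain ⟨x, y, hxy, hθ⟩ := hθ
  refine ⟨(x ⊔ y) ⊓ (x ⊓ y)ᶜ, fun h => hxy (inf_eq_sup.1 ?_), ?_⟩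
  · exact eq_of_le_of_inf_compl_eq_bot inf_le_sup h
  · simpa only [inf_compl] using θ.inf (θ.refl' (x ⊔ y)) (θ.compl (θ.r_inf_sup_iff.2 hθ))

theorem isSubdirectlyIrreducibleMOL_of_inf_compl {p : L} (hp : p ≠ ⊥)
    (h : ∀ z : L, z ≠ ⊥ → ∃ q, q ⊓ zᶜ = ⊥ ∧ p ⊓ qᶜ = ⊥) : IsSubdirectlyIrreducibleMOL L := by
  refine ⟨.collapse p, ⟨p, ⊥, hp, fun _ => id⟩, fun θ hθ x y hxy => hxy θ ?_⟩
  obtain ⟨z, hz0, hz⟩ := hθ.exists_rel_bot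
  obtain ⟨q, hqz, hpq⟩ := h z hz0
  exact θ.rel_bot_of_inf_compl_eq_bot (θ.rel_bot_of_inf_compl_eq_bot hz hqz) hpq

theorem latticeHeight_eq_top_of_forall_exists_le (B : L → Prop) (hbot : B ⊥) (htop : ¬ B ⊤)
    (h : ∀ z : L, z ≠ ⊥ → ∃ w ≤ z, w ≠ ⊥ ∧ ∀ b, B b → B (b ⊔ w)) : latticeHeight L = ⊤ := by
  refine iInf_eq_top.2 fun ⟨c, hc⟩ => ?_
  suffices c.Infinite by simp [this.encard_eq]
  intro hfin
  let F : Flag L := .ofIsMaxChain c hc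
  have : Finite F := hfin
  obtain ⟨b, hb : B b, hmax⟩ := (Set.toFinite {b : F | B b}).exists_maximal ⟨⊥, hbot⟩
  have hbtop : ¬IsMax b := fun h => htop (by simpa only [h.eq_top] using! hb)
  obtain ⟨b', hbb'⟩ := exists_covBy_of_wellFoundedLT hbtop
  have hcov : (b : L) ⋖ b' := Flag.coe_covBy_coe.2 hbb'
  obtain ⟨w, hw, hw0, hwB⟩ := h (b' ⊓ (b : L)ᶜ) fun h0 =>
    hcov.ne (eq_of_le_of_inf_compl_eq_bot hcov.le h0)
  have hwb : ¬w ≤ b := fun hwb => hw0 (le_bot_iff.1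
    ((le_inf hwb (hw.trans inf_le_right)).trans_eq (inf_compl _)))
  have hsup : (b : L) ⊔ w = b' := (hcov.eq_or_eq le_sup_left
    (sup_le hcov.le (hw.trans inf_le_left))).resolve_left fun h => hwb (sup_eq_left.1 h)
  exact hbb'.lt.not_ge (hmax (show B b' from hsup ▸ hwB b hb) hbb'.le)

end Ortholattice

section Frames

open FrameData

/-- The quotient map onto a reduced product. -/
def reducedProductMk {κ : Type*} (F : Filter κ) (L : κ → Type*)
    [∀ k, ModularOrtholattice (L k)] : BoundedLatticeHom (∀ k, L k) (F.Product L) where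
  toFun := Quotient.mk _
  map_sup' _ _ := rfl
  map_inf' _ _ := rfl
  map_top' := rfl
  map_bot' := rfl

theorem reducedProductMk_eq_iff {κ : Type*} {F : Filter κ} {L : κ → Type*}
    [∀ k, ModularOrtholattice (L k)] {x y : ∀ k, L k} :
    reducedProductMk F L x = reducedProductMk F L y ↔ ∀ᶠ k in F, x k = y k :=
  Quotient.eq

theorem FrameData.IsFrame.product {κ : Type*} (F : Filter κ) {L : κ → Type*}
    [∀ k, ModularOrtholattice (L k)] {n : ℕ} {a : ∀ k, FrameData n (L k)}
    (h : ∀ k, (a k).IsFrame) : (FrameData.product F a).IsFrame := by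
  intro j k l hjk hkl hjl
  let q := reducedProductMk F L
  have hsup : (Finset.univ.erase j).sup (FrameData.product F a).pt =
      q ((Finset.univ.erase j).sup fun i r => (a r).pt i) := (map_finset_sup q _ _).symm
  have hinf : Finset.univ.inf (FrameData.product F a).pt =
      q (Finset.univ.inf fun i r => (a r).pt i) := (map_finset_inf q _ _).symm
  rw [hsup, hinf]
  have hr (r : κ) := h r j k l hjk hkl hjl
  refine ⟨congrArg q (funext fun r => ?_), congrArg q (funext fun r => ?_),
    congrArg q (funext fun r => (hr r).2.2.1), congrArg q (funext fun r => (hr r).2.2.2.1),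
    congrArg q (funext fun r => (hr r).2.2.2.2)⟩
  · simpa only [Finset.sup_apply, Finset.inf_apply] using (hr r).1
  · simpa only [Finset.inf_apply] using (hr r).2.1

theorem FrameData.IsOrthogonal.product {κ : Type*} (F : Filter κ) {L : κ → Type*}
    [∀ k, ModularOrtholattice (L k)] {n : ℕ} {a : ∀ k, FrameData n (L k)}
    (h : ∀ k, (a k).IsOrthogonal) : (FrameData.product F a).IsOrthogonal :=
  fun i j hij => Filter.Eventually.of_forall fun k => h k i j hij

variable {L : Type*} [ModularOrtholattice L]

/-- The inclusion of a subalgebra. -/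
def SubMOL.subtype (S : SubMOL L) : BoundedLatticeHom S.Elem L where
  toFun := Subtype.val
  map_sup' _ _ := rfl
  map_inf' _ _ := rfl
  map_top' := rfl
  map_bot' := rfl

theorem FrameData.IsFrame.of_subtype {n : ℕ} {S : SubMOL L} {a : FrameData n S.Elem}
    {b : FrameData n L} (hpt : ∀ i, (a.pt i).1 = b.pt i)
    (hax : ∀ i j, i ≠ j → (a.ax i j).1 = b.ax i j) (hb : b.IsFrame) : a.IsFrame := by
  intro j k l hjk hkl hjl
  have hval : Subtype.val ∘ a.pt = b.pt := funext hpt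
  have hsup (s : Finset (Fin n)) : (s.sup a.pt).1 = s.sup b.pt :=
    hval ▸ map_finset_sup S.subtype s a.pt
  have hinf (s : Finset (Fin n)) : (s.inf a.pt).1 = s.inf b.pt :=
    hval ▸ map_finset_inf S.subtype s a.pt
  obtain ⟨h₁, h₂, h₃, h₄, h₅⟩ := hb j k l hjk hkl hjl
  rw [← hinf, ← hpt] at h₁ h₂
  rw [← hsup] at h₁
  rw [← hpt, ← hpt, ← hax _ _ hjk] at h₃
  rw [← hax _ _ hjk] at h₂
  rw [← hax _ _ hjl, ← hax _ _ hjl.symm] at h₄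
  rw [← hax _ _ hjl, ← hax _ _ hjk, ← hax _ _ hkl, ← hpt, ← hpt] at h₅
  exact ⟨Subtype.ext h₁, Subtype.ext h₂, Subtype.ext h₃, Subtype.ext h₄, Subtype.ext h₅⟩

theorem SubMOL.subset_closure (s : Set L) : s ⊆ (SubMOL.closure s).carrier :=
  fun _ hx _ hT => hT hx

namespace FrameData

variable {n : ℕ}

theorem pt_mem_closure (a : FrameData n L) (i : Fin n) :
    a.pt i ∈ (SubMOL.closure a.elems).carrier :=
  SubMOL.subset_closure _ (Or.inl ⟨i, rfl⟩)

theorem ax_mem_closure (a : FrameData n L) {i j : Fin n} (h : i ≠ j) :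
    a.ax i j ∈ (SubMOL.closure a.elems).carrier :=
  SubMOL.subset_closure _ (Or.inr ⟨i, j, h, rfl⟩)

/-- The frame `a` as a frame in the subalgebra it generates. The entries `ax i i` are set to `⊥`
because `a.ax i i` need not lie in that subalgebra. -/
noncomputable def inClosure (a : FrameData n L) :
    FrameData n (SubMOL.closure a.elems).Elem where
  pt i := ⟨a.pt i, a.pt_mem_closure i⟩
  ax i j := if h : i ≠ j then ⟨a.ax i j, a.ax_mem_closure h⟩ else ⊥

theorem inClosure_ax (a : FrameData n L) {i j : Fin n} (h : i ≠ j) :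
    a.inClosure.ax i j = ⟨a.ax i j, a.ax_mem_closure h⟩ :=
  dif_pos h

theorem generates_inClosure (a : FrameData n L) : a.inClosure.Generates := by
  rintro ⟨_, hx⟩ T hT
  let T' : SubMOL L :=
    { carrier := {y | ∃ h : y ∈ (SubMOL.closure a.elems).carrier, ⟨y, h⟩ ∈ T.carrier}
      bot_mem := ⟨_, T.bot_mem⟩
      top_mem := ⟨_, T.top_mem⟩
      sup_mem := fun ⟨_, h⟩ ⟨_, h'⟩ => ⟨_, T.sup_mem h h'⟩
      inf_mem := fun ⟨_, h⟩ ⟨_, h'⟩ => ⟨_, T.inf_mem h h'⟩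
      compl_mem := fun ⟨_, h⟩ => ⟨_, T.compl_mem h⟩ }
  have hT' : a.elems ⊆ T'.carrier := by
    rintro y (⟨i, rfl⟩ | ⟨i, j, hij, rfl⟩)
    · exact ⟨a.pt_mem_closure i, hT (Or.inl ⟨i, rfl⟩)⟩
    · exact ⟨a.ax_mem_closure hij, hT (Or.inr ⟨i, j, hij, (a.inClosure_ax hij).symm⟩)⟩
  exact (hx T' hT').2

theorem isGeneratingOrthogonalFrame_inClosure {a : FrameData n L} (h : a.IsFrame)
    (h' : a.IsOrthogonal) : a.inClosure.IsGeneratingOrthogonalFrame :=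
  ⟨.of_subtype (fun _ => rfl) (fun _ _ hij => congrArg Subtype.val (a.inClosure_ax hij)) h,
    fun i j hij => h' i j hij, a.generates_inClosure⟩

end FrameData

end Frames

section GraphCalculus

open Matrix

variable {ι τ K : Type*}

section Blocks

variable [Semiring K]

/-- The `i`-th component of a vector of `K^(ι × τ) = (K^τ)^ι`. -/
def blockProj (i : ι) : (ι × τ → K) →ₗ[K] (τ → K) :=
  LinearMap.funLeft K K (Prod.mk i)

/-- The inclusion of the `i`-th summand of `K^(ι × τ) = (K^τ)^ι`. -/
def blockIncl [DecidableEq ι] (i : ι) : (τ → K) →ₗ[K] (ι × τ → K) :=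
  (LinearEquiv.curry K K ι τ).symm.toLinearMap ∘ₗ LinearMap.single K (fun _ => τ → K) i

theorem blockProj_apply (i : ι) (x : ι × τ → K) (t : τ) : blockProj i x t = x (i, t) := rfl

theorem ext_blockProj {x y : ι × τ → K} (h : ∀ i, blockProj i x = blockProj i y) : x = y :=
  funext fun p => congrFun (h p.1) p.2

variable [DecidableEq ι]

theorem blockIncl_apply (i : ι) (u : τ → K) (p : ι × τ) :
    blockIncl i u p = if p.1 = i then u p.2 else 0 := by
  change (Pi.single i u : ι → τ → K) p.1 p.2 = _
  rw [Pi.single_apply]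
  split_ifs <;> rfl

theorem blockProj_blockIncl (i j : ι) (u : τ → K) :
    blockProj i (blockIncl j u) = if i = j then u else 0 := by
  ext t
  rw [blockProj_apply, blockIncl_apply]
  split_ifs <;> rfl

@[simp]
theorem blockProj_blockIncl_self (i : ι) (u : τ → K) : blockProj i (blockIncl i u) = u := by
  rw [blockProj_blockIncl, if_pos rfl]

theorem blockIncl_injective (i : ι) :
    Function.Injective (blockIncl i : (τ → K) →ₗ[K] (ι × τ → K)) :=
  Function.LeftInverse.injective (blockProj_blockIncl_self i)

theorem blockIncl_single [DecidableEq τ] (i : ι) (t : τ) (c : K) :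
    blockIncl i (Pi.single t c) = Pi.single (i, t) c := by
  ext ⟨m, s⟩
  simp only [blockIncl_apply, Pi.single_apply, Prod.mk.injEq, ite_and]

theorem sum_blockIncl_blockProj [Fintype ι] (x : ι × τ → K) :
    ∑ i, blockIncl i (blockProj i x) = x :=
  ext_blockProj fun j => by simp [map_sum, blockProj_blockIncl]

end Blocks

variable [CommRing K] [DecidableEq ι]

/-- The `i`-th summand of `K^(ι × τ) = (K^τ)^ι`, as a subspace. -/
def axisSub (i : ι) : Submodule K (ι × τ → K) := LinearMap.range (blockIncl i)

theorem axisSub_inf_sup {i j l : ι} (hij : i ≠ j) (hil : i ≠ l) :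
    (axisSub i : Submodule K (ι × τ → K)) ⊓ (axisSub j ⊔ axisSub l) = ⊥ := by
  rw [eq_bot_iff]
  rintro x ⟨⟨u, rfl⟩, hx⟩
  obtain ⟨_, ⟨v, rfl⟩, _, ⟨w, rfl⟩, h⟩ := Submodule.mem_sup.1 hx
  have hi : u = 0 := by simpa [blockProj_blockIncl, hij, hil] using congrArg (blockProj i) h.symm
  simp [hi]

variable [Fintype τ]

/-- The negative graph `{u - r u}` of the matrix `r`, as a map from the `i`-th to the `j`-th
summand of `(K^τ)^ι`. The sign is that of von Neumann's coordinatization. -/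
def graphSub (i j : ι) (r : Matrix τ τ K) : Submodule K (ι × τ → K) :=
  LinearMap.range (blockIncl i - blockIncl j ∘ₗ r.mulVecLin)

/-- The image of the matrix `r` in the `i`-th summand of `(K^τ)^ι`. -/
def imageSub (i : ι) (r : Matrix τ τ K) : Submodule K (ι × τ → K) :=
  LinearMap.range (blockIncl i ∘ₗ r.mulVecLin)

theorem graphSub_zero (i j : ι) : graphSub i j (0 : Matrix τ τ K) = axisSub i := by
  simp only [graphSub, axisSub, mulVecLin_zero, LinearMap.comp_zero, sub_zero]

theorem graphSub_le_sup (i j : ι) (r : Matrix τ τ K) :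
    graphSub i j r ≤ axisSub i ⊔ axisSub j := by
  rintro _ ⟨u, rfl⟩
  exact sub_mem (Submodule.mem_sup_left ⟨u, rfl⟩) (Submodule.mem_sup_right ⟨r *ᵥ u, rfl⟩)

theorem axisSub_sup_graphSub_one [DecidableEq τ] (i j : ι) :
    axisSub i ⊔ graphSub i j (1 : Matrix τ τ K) = axisSub i ⊔ axisSub j := by
  refine le_antisymm (sup_le le_sup_left (graphSub_le_sup i j 1)) (sup_le le_sup_left ?_)
  rintro _ ⟨u, rfl⟩
  refine Submodule.mem_sup.2 ⟨blockIncl i u, ⟨u, rfl⟩, _, ⟨-u, rfl⟩, ?_⟩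
  simp

theorem graphSub_le_graphSub_of_mul_eq_one [DecidableEq τ] (i j : ι) {r s : Matrix τ τ K}
    (h : s * r = 1) : graphSub i j r ≤ graphSub j i s := by
  rintro _ ⟨u, rfl⟩
  refine ⟨-(r *ᵥ u), ?_⟩
  simp [mulVec_neg, mulVec_mulVec, h, neg_add_eq_sub]

theorem graphSub_swap [DecidableEq τ] (i j : ι) {r s : Matrix τ τ K} (h : r * s = 1) :
    graphSub i j r = graphSub j i s :=
  le_antisymm (graphSub_le_graphSub_of_mul_eq_one i j (mul_eq_one_comm.1 h))
    (graphSub_le_graphSub_of_mul_eq_one j i h)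

theorem axisSub_inf_graphSub_one [DecidableEq τ] {i j : ι} (hij : i ≠ j) :
    axisSub i ⊓ graphSub i j (1 : Matrix τ τ K) = ⊥ := by
  rw [eq_bot_iff]
  rintro _ ⟨⟨u, rfl⟩, v, hv⟩
  have hi : v = u := by simpa [blockProj_blockIncl, hij] using congrArg (blockProj i) hv
  have hj : v = 0 := by simpa [blockProj_blockIncl, hij.symm] using congrArg (blockProj j) hv
  simp [← hi, hj]

theorem graphSub_mul {i j l : ι} (hij : i ≠ j) (hjl : j ≠ l) (r s : Matrix τ τ K) :
    (graphSub i j r ⊔ graphSub j l s) ⊓ (axisSub i ⊔ axisSub l) = graphSub i l (s * r) := by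
  refine le_antisymm ?_ (le_inf ?_ (graphSub_le_sup i l _))
  · rintro x ⟨hx, hx'⟩
    obtain ⟨_, ⟨u, rfl⟩, _, ⟨v, rfl⟩, rfl⟩ := Submodule.mem_sup.1 hx
    obtain ⟨_, ⟨p, rfl⟩, _, ⟨q, rfl⟩, h⟩ := Submodule.mem_sup.1 hx'
    have hj : 0 = -(r *ᵥ u) + v := by
      simpa [blockProj_blockIncl, hij.symm, hjl] using congrArg (blockProj j) h
    obtain rfl : v = r *ᵥ u := by linear_combination -hj
    exact ⟨u, by simp [mulVec_mulVec]⟩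
  · rintro _ ⟨u, rfl⟩
    refine Submodule.mem_sup.2 ⟨_, ⟨u, rfl⟩, _, ⟨r *ᵥ u, rfl⟩, ?_⟩
    simp [mulVec_mulVec]

section ThreeIndices

variable {i j l : ι} (hij : i ≠ j) (hjl : j ≠ l) (hil : i ≠ l)

include hij hjl hil

theorem graphSub_sup_axisSub_inf_graphSub_sup_axisSub (r s : Matrix τ τ K) :
    (graphSub i j r ⊔ axisSub l) ⊓ (graphSub i l s ⊔ axisSub j) =
      LinearMap.range (blockIncl i - blockIncl j ∘ₗ r.mulVecLin - blockIncl l ∘ₗ s.mulVecLin) := by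
  refine le_antisymm ?_ ?_
  · rintro x ⟨hx, hx'⟩
    obtain ⟨_, ⟨u, rfl⟩, _, ⟨a, rfl⟩, rfl⟩ := Submodule.mem_sup.1 hx
    obtain ⟨_, ⟨v, rfl⟩, _, ⟨b, rfl⟩, h⟩ := Submodule.mem_sup.1 hx'
    obtain rfl : v = u := by
      simpa [blockProj_blockIncl, hij, hil] using congrArg (blockProj i) h
    obtain rfl : -(s *ᵥ v) = a := by
      simpa [blockProj_blockIncl, hil.symm, hjl.symm] using congrArg (blockProj l) h
    exact ⟨v, by simp [sub_eq_add_neg]⟩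
  · rintro _ ⟨u, rfl⟩
    refine ⟨Submodule.mem_sup.2 ⟨_, ⟨u, rfl⟩, _, ⟨-(s *ᵥ u), rfl⟩, ?_⟩,
      Submodule.mem_sup.2 ⟨_, ⟨u, rfl⟩, _, ⟨-(r *ᵥ u), rfl⟩, ?_⟩⟩
    · simp [sub_eq_add_neg]
    · simp [sub_eq_add_neg, add_right_comm]

theorem graphSub_sup_axisSub_inf_span_singleton_sup (r s : Matrix τ τ K) (w : τ → K) :
    (graphSub i j r ⊔ axisSub l) ⊓ (graphSub i l s ⊔ axisSub j) ⊓
      (Submodule.span K {blockIncl i w} ⊔ (axisSub j ⊔ axisSub l)) =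
        Submodule.span K {blockIncl i w - blockIncl j (r *ᵥ w) - blockIncl l (s *ᵥ w)} := by
  rw [graphSub_sup_axisSub_inf_graphSub_sup_axisSub hij hjl hil]
  refine le_antisymm ?_ ?_
  · rintro _ ⟨⟨u, rfl⟩, hy⟩
    obtain ⟨_, hx, _, hz, h⟩ := Submodule.mem_sup.1 hy
    obtain ⟨c, rfl⟩ := Submodule.mem_span_singleton.1 hx
    obtain ⟨_, ⟨p, rfl⟩, _, ⟨q, rfl⟩, rfl⟩ := Submodule.mem_sup.1 hz
    obtain rfl : c • w = u := by
      simpa [blockProj_blockIncl, hij, hil] using congrArg (blockProj i) h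
    exact Submodule.mem_span_singleton.2 ⟨c, by simp [smul_sub]⟩
  · rw [Submodule.span_singleton_le_iff_mem]
    refine ⟨⟨w, rfl⟩, ?_⟩
    rw [sub_sub]
    exact sub_mem (Submodule.mem_sup_left (Submodule.mem_span_singleton_self _))
      (Submodule.mem_sup_right (Submodule.add_mem_sup ⟨_, rfl⟩ ⟨_, rfl⟩))

theorem graphSub_sub [DecidableEq τ] (r s : Matrix τ τ K) :
    (graphSub i j r ⊔ (graphSub i j s ⊔ axisSub l) ⊓ (graphSub i l 1 ⊔ axisSub j)) ⊓
      (axisSub l ⊔ axisSub j) = graphSub l j (r - s) := by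
  rw [graphSub_sup_axisSub_inf_graphSub_sup_axisSub hij hjl hil]
  refine le_antisymm ?_ (le_inf ?_ (graphSub_le_sup l j _))
  · rintro x ⟨hx, hx'⟩
    obtain ⟨_, ⟨u, rfl⟩, _, ⟨v, rfl⟩, rfl⟩ := Submodule.mem_sup.1 hx
    obtain ⟨_, ⟨p, rfl⟩, _, ⟨q, rfl⟩, h⟩ := Submodule.mem_sup.1 hx'
    have hi : 0 = u + v := by
      simpa [blockProj_blockIncl, hij, hil] using congrArg (blockProj i) h
    obtain rfl : u = -v := by linear_combination -hi
    refine ⟨-v, ?_⟩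
    simp only [map_sub, LinearMap.sub_apply, map_neg, LinearMap.coe_comp, Function.comp_apply,
      mulVecBilin_apply, mulVecLin_one, LinearMap.comp_id]
    abel
  · rintro _ ⟨u, rfl⟩
    refine Submodule.mem_sup.2 ⟨_, ⟨u, rfl⟩, _, ⟨-u, rfl⟩, ?_⟩
    simp only [LinearMap.sub_apply, LinearMap.coe_comp, Function.comp_apply, mulVecBilin_apply,
      mulVecLin_one, LinearMap.comp_id, map_neg, map_sub]
    abel

end ThreeIndices

theorem graphSub_sup_axisSub_inf_axisSub {i j : ι} (hij : i ≠ j) (r : Matrix τ τ K) :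
    (graphSub i j r ⊔ axisSub i) ⊓ axisSub j = imageSub j r := by
  refine le_antisymm ?_ ?_
  · rintro x ⟨hx, q, rfl⟩
    obtain ⟨_, ⟨u, rfl⟩, _, ⟨v, rfl⟩, h⟩ := Submodule.mem_sup.1 hx
    have hj : q = -(r *ᵥ u) := by
      simpa [blockProj_blockIncl, hij.symm] using congrArg (blockProj j) h.symm
    exact ⟨-u, by simp [mulVec_neg, hj]⟩
  · rintro _ ⟨u, rfl⟩
    refine ⟨Submodule.mem_sup.2 ⟨_, ⟨-u, rfl⟩, _, ⟨u, rfl⟩, ?_⟩, _, rfl⟩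
    simp [mulVec_neg]

theorem imageSub_vecMulVec (i : ι) (w : τ → K) {v u : τ → K} (h : v ⬝ᵥ u = 1) :
    imageSub i (vecMulVec w v) = Submodule.span K {blockIncl i w} := by
  refine le_antisymm ?_ ?_
  · rintro _ ⟨y, rfl⟩
    refine Submodule.mem_span_singleton.2 ⟨v ⬝ᵥ y, ?_⟩
    simp [vecMulVec_mulVec]
  · rw [Submodule.span_singleton_le_iff_mem]
    exact ⟨u, by simp [vecMulVec_mulVec, h]⟩

theorem imageSub_vecMulVec_one (i : ι) (w : τ → K) :
    imageSub i (vecMulVec w 1) = Submodule.span K {blockIncl i w} := by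
  classical
  rcases isEmpty_or_nonempty τ with _ | ⟨⟨t⟩⟩
  · exact Subsingleton.elim _ _
  · exact imageSub_vecMulVec i w (u := Pi.single t 1) (by simp)

end GraphCalculus

section CoordinateRing

open Matrix

variable {κ K : Type*} [CommRing K] {τ : κ → Type*} [∀ k, Fintype (τ k)] [∀ k, DecidableEq (τ k)]

/-- A lattice of families of subspaces that contains the families of canonical 3-frames. -/
structure ContainsFrames (C : Sublattice (∀ k, Submodule K (Fin 3 × τ k → K))) : Prop where
  axisSub_mem : ∀ i, (fun _ => axisSub i) ∈ C
  graphSub_one_mem : ∀ i j, i ≠ j → (fun _ => graphSub i j 1) ∈ C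

namespace ContainsFrames

variable {C : Sublattice (∀ k, Submodule K (Fin 3 × τ k → K))} (hC : ContainsFrames C)
  {i j l : Fin 3} {r s : ∀ k, Matrix (τ k) (τ k) K}

include hC

theorem graphSub_mul_mem (hij : i ≠ j) (hjl : j ≠ l) (hr : (fun k => graphSub i j (r k)) ∈ C)
    (hs : (fun k => graphSub j l (s k)) ∈ C) : (fun k => graphSub i l (s k * r k)) ∈ C := by
  simp only [← graphSub_mul hij hjl]
  exact C.inf_mem (C.sup_mem hr hs) (C.sup_mem (hC.axisSub_mem i) (hC.axisSub_mem l))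

theorem graphSub_right_mem (hij : i ≠ j) (hjl : j ≠ l) (hr : (fun k => graphSub i j (r k)) ∈ C) :
    (fun k => graphSub i l (r k)) ∈ C := by
  simpa using hC.graphSub_mul_mem hij hjl hr (hC.graphSub_one_mem j l hjl)

theorem graphSub_left_mem (hij : i ≠ j) (hil : i ≠ l) (hr : (fun k => graphSub i j (r k)) ∈ C) :
    (fun k => graphSub l j (r k)) ∈ C := by
  simpa using hC.graphSub_mul_mem hil.symm hij (hC.graphSub_one_mem l i hil.symm) hr

theorem graphSub_mem_of_mem (hij : i ≠ j) (hr : (fun k => graphSub i j (r k)) ∈ C)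
    (i' j' : Fin 3) (hij' : i' ≠ j') : (fun k => graphSub i' j' (r k)) ∈ C := by
  obtain ⟨l, hil, hjl⟩ : ∃ l : Fin 3, i ≠ l ∧ j ≠ l := by clear hr; revert i j; decide
  have hil' := hC.graphSub_right_mem hij hjl hr
  have hlj := hC.graphSub_left_mem hij hil hr
  have hjl' := hC.graphSub_left_mem hil hij hil'
  have hli := hC.graphSub_right_mem hjl.symm hij.symm hlj
  have hji := hC.graphSub_right_mem hjl hil.symm hjl'
  have h : (i' = i ∧ j' = j) ∨ (i' = i ∧ j' = l) ∨ (i' = l ∧ j' = j) ∨ (i' = j ∧ j' = l) ∨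
      (i' = l ∧ j' = i) ∨ (i' = j ∧ j' = i) := by
    clear hil' hlj hjl' hli hji hr; revert i j l i' j'; decide
  rcases h with ⟨rfl, rfl⟩ | ⟨rfl, rfl⟩ | ⟨rfl, rfl⟩ | ⟨rfl, rfl⟩ | ⟨rfl, rfl⟩ | ⟨rfl, rfl⟩ <;>
    assumption

theorem graphSub_sub_mem (hr : (fun k => graphSub 0 1 (r k)) ∈ C)
    (hs : (fun k => graphSub 0 1 (s k)) ∈ C) : (fun k => graphSub 2 1 (r k - s k)) ∈ C := by
  simp only [← graphSub_sub (i := (0 : Fin 3)) (j := 1) (l := 2) (by decide) (by decide)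
    (by decide)]
  exact C.inf_mem
    (C.sup_mem hr (C.inf_mem (C.sup_mem hs (hC.axisSub_mem 2))
      (C.sup_mem (hC.graphSub_one_mem 0 2 (by decide)) (hC.axisSub_mem 1))))
    (C.sup_mem (hC.axisSub_mem 2) (hC.axisSub_mem 1))

/-- Von Neumann's coordinate ring of a lattice of families of subspaces: the families of matrices
whose graphs belong to the lattice. -/
def coordRing : Subring (∀ k, Matrix (τ k) (τ k) K) :=
  have zero_mem i j (_ : i ≠ j) : (fun k => graphSub i j (0 : Matrix (τ k) (τ k) K)) ∈ C := by
    simpa only [graphSub_zero] using hC.axisSub_mem i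
  have sub_mem {r s : ∀ k, Matrix (τ k) (τ k) K}
      (hr : ∀ i j, i ≠ j → (fun k => graphSub i j (r k)) ∈ C)
      (hs : ∀ i j, i ≠ j → (fun k => graphSub i j (s k)) ∈ C) :=
    hC.graphSub_mem_of_mem (by decide)
      (hC.graphSub_sub_mem (hr 0 1 (by decide)) (hs 0 1 (by decide)))
  { carrier := {r | ∀ i j, i ≠ j → (fun k => graphSub i j (r k)) ∈ C}
    one_mem' := hC.graphSub_one_mem
    zero_mem' := zero_mem
    mul_mem' := fun {r s} hr hs => hC.graphSub_mem_of_mem (i := 0) (j := 2) (by decide)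
      (hC.graphSub_mul_mem (by decide) (by decide) (hs 0 1 (by decide)) (hr 1 2 (by decide)))
    neg_mem' := fun {r} hr => by simpa using sub_mem zero_mem hr
    add_mem' := fun {r s} hr hs => by simpa using sub_mem hr (sub_mem zero_mem hs) }

theorem mem_coordRing_of_mem (hij : i ≠ j) (hr : (fun k => graphSub i j (r k)) ∈ C) :
    r ∈ hC.coordRing := hC.graphSub_mem_of_mem hij hr

theorem mem_coordRing_of_mul_eq_one (hrs : r * s = 1) (hr : r ∈ hC.coordRing) :
    s ∈ hC.coordRing := by
  have h (k) : graphSub 0 1 (r k) = graphSub (1 : Fin 3) 0 (s k) :=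
    graphSub_swap 0 1 (congrFun hrs k)
  refine hC.mem_coordRing_of_mem (i := 1) (j := 0) (by decide) ?_
  simpa only [h] using hr 0 1 (by decide)

theorem imageSub_mem (hr : r ∈ hC.coordRing) (j : Fin 3) : (fun k => imageSub j (r k)) ∈ C := by
  obtain ⟨i, hij⟩ : ∃ i : Fin 3, i ≠ j := exists_ne j
  simp only [← graphSub_sup_axisSub_inf_axisSub hij]
  exact C.inf_mem (C.sup_mem (hr i j hij) (hC.axisSub_mem i)) (hC.axisSub_mem j)

theorem span_singleton_mem (hij : i ≠ j) (hjl : j ≠ l) (hil : i ≠ l) (hr : r ∈ hC.coordRing)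
    (hs : s ∈ hC.coordRing) {w : ∀ k, τ k → K}
    (hw : (fun k => Submodule.span K {blockIncl i (w k)}) ∈ C) :
    (fun k => Submodule.span K
      {blockIncl i (w k) - blockIncl j (r k *ᵥ w k) - blockIncl l (s k *ᵥ w k)}) ∈ C := by
  simp only [← graphSub_sup_axisSub_inf_span_singleton_sup hij hjl hil]
  exact C.inf_mem
    (C.inf_mem (C.sup_mem (hr i j hij) (hC.axisSub_mem l))
      (C.sup_mem (hs i l hil) (hC.axisSub_mem j)))
    (C.sup_mem hw (C.sup_mem (hC.axisSub_mem j) (hC.axisSub_mem l)))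

end ContainsFrames

end CoordinateRing

section Forms

open Matrix

/-- The form `(x, y) ↦ xᵀ G y` with positive definite Gram matrix `G`. -/
def PosDefForm.ofMatrix {ι : Type*} [Fintype ι] [DecidableEq ι] (G : Matrix ι ι ℚ)
    (hG : G.PosDef) : PosDefForm ι where
  form := Matrix.toBilin' G
  symm x y := by
    have hT : Gᵀ = G := by simpa using hG.isHermitian.eq
    rw [toBilin'_apply', toBilin'_apply', dotProduct_mulVec, ← mulVec_transpose, hT,
      dotProduct_comm]
  pos x hx := by
    simpa [toBilin'_apply'] using hG.dotProduct_mulVec_pos hx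

theorem PosDefForm.ofMatrix_form_apply {ι : Type*} [Fintype ι] [DecidableEq ι] {G : Matrix ι ι ℚ}
    (hG : G.PosDef) (x y : ι → ℚ) : (PosDefForm.ofMatrix G hG).form x y = x ⬝ᵥ G *ᵥ y :=
  toBilin'_apply' G x y

theorem blockIncl_dotProduct {ι τ K : Type*} [Fintype ι] [Fintype τ] [DecidableEq ι] [Semiring K]
    (i : ι) (u : τ → K) (z : ι × τ → K) : blockIncl i u ⬝ᵥ z = u ⬝ᵥ blockProj i z := by
  simp [dotProduct, Fintype.sum_prod_type, blockIncl_apply, blockProj_apply, ite_mul]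

variable {τ : Type*} [Fintype τ] [DecidableEq τ]

/-- The Gram matrix of the orthogonal sum of three forms on `ℚ^τ`: the standard one, the one with
Gram matrix `diag d`, and the one whose Gram matrix is the sum of `1` and the all-ones matrix. -/
def gramMatrix (d : τ → ℚ) : Matrix (Fin 3 × τ) (Fin 3 × τ) ℚ :=
  diagonal (fun p => ![1, d p.2, 1] p.1) + vecMulVec (blockIncl 2 1) (blockIncl 2 1)

/-- The three diagonal blocks of `gramMatrix d`. -/
def gramBlock (d : τ → ℚ) : Fin 3 → Matrix τ τ ℚ := ![1, diagonal d, 1 + vecMulVec 1 1]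

theorem blockProj_gramMatrix_mulVec (d : τ → ℚ) (i : Fin 3) (x : Fin 3 × τ → ℚ) :
    blockProj i (gramMatrix d *ᵥ x) = gramBlock d i *ᵥ blockProj i x := by
  ext t
  fin_cases i <;>
    simp [-vecMulVec_one, -one_vecMulVec, gramMatrix, gramBlock, add_mulVec, mulVec_diagonal,
      vecMulVec_mulVec, blockProj_apply, blockIncl_apply, blockIncl_dotProduct]

omit [Fintype τ] in
theorem posDef_gramMatrix [Finite τ] {d : τ → ℚ} (hd : ∀ t, 0 < d t) : (gramMatrix d).PosDef := by
  refine (PosDef.diagonal fun p => ?_).add_posSemidef ?_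
  · obtain ⟨i, t⟩ := p
    fin_cases i
    exacts [one_pos, hd t, one_pos]
  · simpa using posSemidef_vecMulVec_self_star (blockIncl 2 1 : Fin 3 × τ → ℚ)

/-- The positive definite form on `ℚ^(3τ)` with Gram matrix `gramMatrix d`. -/
def gramForm (d : τ → ℚ) (hd : ∀ t, 0 < d t) : PosDefForm (Fin 3 × τ) :=
  PosDefForm.ofMatrix (gramMatrix d) (posDef_gramMatrix hd)

variable (d : τ → ℚ) (hd : ∀ t, 0 < d t) {i j : Fin 3}

theorem gramForm_blockIncl (i : Fin 3) (u : τ → ℚ) (x : Fin 3 × τ → ℚ) :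
    (gramForm d hd).form (blockIncl i u) x = u ⬝ᵥ gramBlock d i *ᵥ blockProj i x := by
  rw [gramForm, PosDefForm.ofMatrix_form_apply, blockIncl_dotProduct, blockProj_gramMatrix_mulVec]

theorem axisSub_le_orthogonal_axisSub (hij : i ≠ j) :
    axisSub i ≤ (gramForm d hd).form.orthogonal (axisSub j) := by
  rintro _ ⟨u, rfl⟩ _ ⟨v, rfl⟩
  rw [gramForm_blockIncl, blockProj_blockIncl, if_neg hij.symm,
    mulVec_zero, dotProduct_zero]

theorem mem_orthogonal_graphSub_one {x : Fin 3 × τ → ℚ} :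
    x ∈ (gramForm d hd).form.orthogonal (graphSub i j 1) ↔
      gramBlock d i *ᵥ blockProj i x = gramBlock d j *ᵥ blockProj j x := by
  have h (u : τ → ℚ) : (gramForm d hd).form (blockIncl i u - blockIncl j u) x =
      u ⬝ᵥ (gramBlock d i *ᵥ blockProj i x - gramBlock d j *ᵥ blockProj j x) := by
    rw [map_sub, LinearMap.sub_apply, gramForm_blockIncl, gramForm_blockIncl, dotProduct_sub]
  rw [← sub_eq_zero, ← dotProduct_eq_zero_iff]
  constructor
  · intro hx u
    rw [dotProduct_comm, ← h]
    exact hx _ ⟨u, by simp⟩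
  · rintro hx _ ⟨u, rfl⟩
    have hu : u ⬝ᵥ (gramBlock d i *ᵥ blockProj i x - gramBlock d j *ᵥ blockProj j x) = 0 := by
      rw [dotProduct_comm, hx]
    simpa [← h] using hu

theorem orthogonal_graphSub_one_inf (hij : i ≠ j) (hi : gramBlock d i = 1) :
    (gramForm d hd).form.orthogonal (graphSub i j 1) ⊓ (axisSub i ⊔ axisSub j) =
      graphSub j i (-gramBlock d j) := by
  ext x
  rw [Submodule.mem_inf, mem_orthogonal_graphSub_one, hi, one_mulVec]
  constructor
  · rintro ⟨h, hx⟩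
    obtain ⟨_, ⟨u, rfl⟩, _, ⟨v, rfl⟩, rfl⟩ := Submodule.mem_sup.1 hx
    obtain rfl : u = gramBlock d j *ᵥ v := by
      simpa [blockProj_blockIncl, hij, hij.symm] using h
    exact ⟨v, by simp [add_comm]⟩
  · rintro ⟨v, rfl⟩
    refine ⟨?_, sup_comm (axisSub (K := ℚ) (τ := τ) j) (axisSub i) ▸
      graphSub_le_sup j i (-gramBlock d j) ⟨v, rfl⟩⟩
    simp [blockProj_blockIncl, hij, hij.symm]

end Forms

namespace ContainsFrames

open Matrix

variable {κ : Type*} {τ : κ → Type*} [∀ k, Fintype (τ k)] [∀ k, DecidableEq (τ k)]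
  {C : Sublattice (∀ k, Submodule ℚ (Fin 3 × τ k → ℚ))} {d : ∀ k, τ k → ℚ} {hd : ∀ k t, 0 < d k t}

theorem gramBlock_mem_coordRing (hC : ContainsFrames C)
    (hC' : ∀ X ∈ C, (fun k => (gramForm (d k) (hd k)).form.orthogonal (X k)) ∈ C) (i : Fin 3) :
    (fun k => gramBlock (d k) i) ∈ hC.coordRing := by
  obtain rfl | hi := eq_or_ne 0 i
  · exact one_mem hC.coordRing
  rw [← neg_mem_iff]
  refine hC.mem_coordRing_of_mem (i := i) (j := 0) hi.symm ?_
  have h (k) : graphSub i 0 (-gramBlock (d k) i) =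
      (gramForm (d k) (hd k)).form.orthogonal (graphSub 0 i 1) ⊓ (axisSub 0 ⊔ axisSub i) :=
    (orthogonal_graphSub_one_inf (d k) (hd k) hi rfl).symm
  simp only [Pi.neg_apply, h]
  exact C.inf_mem (hC' _ (hC.graphSub_one_mem 0 i hi))
    (C.sup_mem (hC.axisSub_mem 0) (hC.axisSub_mem i))

theorem diagonal_mem_coordRing (hC : ContainsFrames C)
    (hC' : ∀ X ∈ C, (fun k => (gramForm (d k) (hd k)).form.orthogonal (X k)) ∈ C) :
    (fun k => diagonal (d k)) ∈ hC.coordRing :=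
  hC.gramBlock_mem_coordRing hC' 1

theorem vecMulVec_one_mem_coordRing (hC : ContainsFrames C)
    (hC' : ∀ X ∈ C, (fun k => (gramForm (d k) (hd k)).form.orthogonal (X k)) ∈ C) :
    (fun _ => vecMulVec 1 1) ∈ hC.coordRing := by
  have h (k) : vecMulVec 1 1 = gramBlock (d k) 2 - 1 := (add_sub_cancel_left _ _).symm
  simp only [h]
  exact sub_mem (hC.gramBlock_mem_coordRing hC' 2) (one_mem _)

end ContainsFrames

section Generation

open Matrix

theorem subalgebra_pi_eq_top {τ K : Type*} [Finite τ] [Field K] {A : Subalgebra K (τ → K)}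
    {d : τ → K} (hd : Function.Injective d) (hA : d ∈ A) : A = ⊤ := by
  classical
  have := Fintype.ofFinite τ
  refine eq_top_iff.2 fun f _ => ?_
  have hf : Polynomial.aeval d (Lagrange.interpolate Finset.univ d f) = f := by
    ext t
    rw [Polynomial.aeval_pi_apply₂, Polynomial.coe_aeval_eq_eval]
    exact Lagrange.eval_interpolate_at_node f hd.injOn (Finset.mem_univ t)
  exact hf ▸ Algebra.adjoin_le (Set.singleton_subset_iff.2 hA)
    (Polynomial.aeval_mem_adjoin_singleton K d)

theorem subalgebra_matrix_eq_top {τ K : Type*} [Fintype τ] [DecidableEq τ] [Field K]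
    {A : Subalgebra K (Matrix τ τ K)} {d : τ → K} (hd : Function.Injective d)
    (hA : diagonal d ∈ A) (hA' : vecMulVec 1 1 ∈ A) : A = ⊤ := by
  have hdiag (f : τ → K) : diagonal f ∈ A := by
    have h : A.comap (diagonalAlgHom K) = ⊤ := subalgebra_pi_eq_top hd hA
    exact (h ▸ Algebra.mem_top : f ∈ A.comap (diagonalAlgHom K))
  refine eq_top_iff.2 fun M _ => ?_
  rw [matrix_eq_sum_single M]
  refine sum_mem fun i _ => sum_mem fun j _ => ?_
  have h : single i j (M i j) =
      diagonal (Pi.single i (M i j)) * vecMulVec 1 1 * diagonal (Pi.single j 1) := by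
    simp only [diagonal_single, single_mul_mul_single, vecMulVec_apply, Pi.one_apply, mul_one]
  rw [h]
  exact mul_mem (mul_mem (hdiag _) hA') (hdiag _)

theorem algebraMap_rat_mem {A : Type*} [Ring A] [Algebra ℚ A] {R : Subring A}
    (hR : ∀ r s, r * s = 1 → r ∈ R → s ∈ R) (q : ℚ) : algebraMap ℚ A q ∈ R := by
  have hden : algebraMap ℚ A (q.den : ℚ)⁻¹ ∈ R := by
    refine hR (q.den : A) _ ?_ (natCast_mem R _)
    rw [← map_natCast (algebraMap ℚ A), ← map_mul, mul_inv_cancel₀ (by simp), map_one]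
  have h : algebraMap ℚ A q = (q.num : A) * algebraMap ℚ A (q.den : ℚ)⁻¹ := by
    rw [← map_intCast (algebraMap ℚ A), ← map_mul, ← div_eq_mul_inv, Rat.num_div_den]
  exact h ▸ mul_mem (intCast_mem R _) hden

variable {τ : Type*} [Fintype τ] [DecidableEq τ]
  {C : Sublattice (Unit → Submodule ℚ (Fin 3 × τ → ℚ))} (hC : ContainsFrames C)

include hC

theorem ContainsFrames.coordRing_eq_top {d : τ → ℚ} (hinj : Function.Injective d)
    (hd : (fun _ => diagonal d) ∈ hC.coordRing) (h1 : (fun _ => vecMulVec 1 1) ∈ hC.coordRing) :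
    hC.coordRing = ⊤ := by
  refine eq_top_iff.2 fun r _ => ?_
  let R := hC.coordRing.comap (Pi.constRingHom Unit (Matrix τ τ ℚ))
  have hR (r s : Matrix τ τ ℚ) (hrs : r * s = 1) (hr : r ∈ R) : s ∈ R :=
    hC.mem_coordRing_of_mul_eq_one (funext fun _ => hrs) hr
  let A : Subalgebra ℚ (Matrix τ τ ℚ) :=
    { R with algebraMap_mem' := algebraMap_rat_mem hR }
  have hA : A = ⊤ := subalgebra_matrix_eq_top hinj hd h1
  exact (hA ▸ Algebra.mem_top : r () ∈ A)

theorem ContainsFrames.eq_top_of_coordRing_eq_top (h : hC.coordRing = ⊤) : C = ⊤ := by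
  have hr (r : Unit → Matrix τ τ ℚ) : r ∈ hC.coordRing := h ▸ Subring.mem_top r
  refine eq_top_iff.2 fun X _ => ?_
  refine Submodule.fg_induction (motive := fun Y _ => (fun _ => Y) ∈ C) ?_
    (fun _ _ _ _ => C.sup_mem) (X ()) (IsNoetherian.noetherian _)
  intro x
  obtain rfl | hx := eq_or_ne x 0
  · rw [Submodule.span_zero_singleton, ← axisSub_inf_graphSub_one (zero_ne_one (α := Fin 3))]
    exact C.inf_mem (hC.axisSub_mem 0) (hC.graphSub_one_mem 0 1 zero_ne_one)
  obtain ⟨⟨i, t⟩, ht⟩ := Function.ne_iff.1 hx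
  obtain ⟨j, l, hij, hjl, hil, huniv⟩ : ∃ j l : Fin 3, i ≠ j ∧ j ≠ l ∧ i ≠ l ∧
    Finset.univ = {i, j, l} := by clear ht; revert i; decide
  let w := blockProj i x
  let f : τ → ℚ := Pi.single t (x (i, t))⁻¹
  have hf : f ⬝ᵥ w = 1 := (single_dotProduct w _ t).trans (inv_mul_cancel₀ ht)
  have hmul (v : τ → ℚ) : vecMulVec v f *ᵥ w = v := by
    rw [vecMulVec_mulVec, hf, MulOpposite.op_one, one_smul]
  have hw : (fun _ => Submodule.span ℚ {blockIncl i w}) ∈ C := by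
    simpa only [imageSub_vecMulVec i w hf] using hC.imageSub_mem (hr fun _ => vecMulVec w f) i
  have hsum : x = blockIncl i w - blockIncl j (vecMulVec (-blockProj j x) f *ᵥ w) -
      blockIncl l (vecMulVec (-blockProj l x) f *ᵥ w) := by
    rw [hmul, hmul, map_neg, map_neg, sub_neg_eq_add, sub_neg_eq_add]
    conv_lhs => rw [← sum_blockIncl_blockProj x, huniv, Finset.sum_insert (by simp [hij, hil]),
      Finset.sum_pair hjl, ← add_assoc]
  rw [hsum]
  exact hC.span_singleton_mem hij hjl hil (hr _) (hr _) hw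

end Generation

section CanonicalFrame

variable {n : ℕ}

theorem span_range_single_eq_range {τ V K : Type*} [Finite τ] [DecidableEq τ] [Semiring K]
    [AddCommMonoid V] [Module K V] (f : (τ → K) →ₗ[K] V) :
    Submodule.span K (Set.range fun t => f (Pi.single t 1)) = LinearMap.range f := by
  have h : (Set.range fun t => f (Pi.single t 1)) = f '' Set.range (Pi.basisFun K τ) := by
    rw [← Set.range_comp]
    exact congrArg Set.range (funext fun t => congrArg f (Pi.basisFun_apply K τ t).symm)
  rw [h, ← Submodule.map_span, (Pi.basisFun K τ).span_eq, Submodule.map_top]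

theorem canonicalFrame_pt (Φ : PosDefForm (Fin 3 × Fin n)) (i : Fin 3) :
    (canonicalFrame Φ).pt i = (axisSub i : Submodule ℚ (Fin 3 × Fin n → ℚ)) := by
  have h := span_range_single_eq_range
    (blockIncl i : (Fin n → ℚ) →ₗ[ℚ] Fin 3 × Fin n → ℚ)
  simp only [blockIncl_single] at h
  exact h

theorem canonicalFrame_ax (Φ : PosDefForm (Fin 3 × Fin n)) (i j : Fin 3) :
    (canonicalFrame Φ).ax i j = (graphSub i j 1 : Submodule ℚ (Fin 3 × Fin n → ℚ)) := by
  have h := span_range_single_eq_range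
    (blockIncl i - blockIncl j : (Fin n → ℚ) →ₗ[ℚ] Fin 3 × Fin n → ℚ)
  simp only [LinearMap.sub_apply, blockIncl_single] at h
  rw [graphSub, Matrix.mulVecLin_one, LinearMap.comp_id]
  exact h

theorem isFrame_canonicalFrame (Φ : PosDefForm (Fin 3 × Fin n)) : (canonicalFrame Φ).IsFrame := by
  intro j k l hjk hkl hjl
  obtain ⟨herase, huniv⟩ : Finset.univ.erase j = {k, l} ∧ Finset.univ = {j, k, l} := by
    revert j k l; decide
  have hinf : Finset.univ.inf (canonicalFrame Φ).pt = ⊥ := by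
    simp only [huniv, Finset.inf_insert, Finset.inf_singleton, canonicalFrame_pt]
    exact eq_bot_mono (inf_le_inf_left _ (inf_le_left.trans le_sup_left)) (axisSub_inf_sup hjk hjl)
  simp only [hinf, herase, Finset.sup_insert, Finset.sup_singleton, canonicalFrame_pt,
    canonicalFrame_ax]
  refine ⟨axisSub_inf_sup hjk hjl, axisSub_inf_graphSub_one hjk, axisSub_sup_graphSub_one j k,
    graphSub_swap j l (mul_one 1), ?_⟩
  rw [inf_comm]
  exact (mul_one (1 : Matrix (Fin n) (Fin n) ℚ) ▸ graphSub_mul hjk hkl 1 1).symm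

theorem isOrthogonal_canonicalFrame (d : Fin n → ℚ) (hd : ∀ t, 0 < d t) :
    (canonicalFrame (gramForm d hd)).IsOrthogonal := by
  intro i j hij
  rw [canonicalFrame_pt, canonicalFrame_pt]
  exact axisSub_le_orthogonal_axisSub d hd hij

/-- A subalgebra, as a sublattice. -/
def SubMOL.toSublattice {L : Type*} [ModularOrtholattice L] (S : SubMOL L) : Sublattice L where
  carrier := S.carrier
  supClosed' _ hx _ hy := S.sup_mem hx hy
  infClosed' _ hx _ hy := S.inf_mem hx hy

/-- The lattice of families of subspaces whose images under `f` belong to the subalgebra `S`. -/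
def SubMOL.families {κ L : Type*} [ModularOrtholattice L] (S : SubMOL L) {n : κ → ℕ}
    {Φ : ∀ k, PosDefForm (Fin 3 × Fin (n k))} (f : LatticeHom (∀ k, SubspaceMOL (Φ k)) L) :
    Sublattice (∀ k, Submodule ℚ (Fin 3 × Fin (n k) → ℚ)) :=
  S.toSublattice.comap f

theorem SubMOL.containsFrames_families {κ L : Type*} [ModularOrtholattice L] {S : SubMOL L}
    {n : κ → ℕ} {Φ : ∀ k, PosDefForm (Fin 3 × Fin (n k))}
    {f : LatticeHom (∀ k, SubspaceMOL (Φ k)) L}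
    (hpt : ∀ i, f (fun k => (canonicalFrame (Φ k)).pt i) ∈ S.carrier)
    (hax : ∀ i j, i ≠ j → f (fun k => (canonicalFrame (Φ k)).ax i j) ∈ S.carrier) :
    ContainsFrames (S.families f) where
  axisSub_mem i := by simpa only [canonicalFrame_pt] using! hpt i
  graphSub_one_mem i j hij := by simpa only [canonicalFrame_ax] using! hax i j hij

theorem isGeneratingOrthogonalFrame_canonicalFrame {d : Fin n → ℚ} (hd : ∀ t, 0 < d t)
    (hinj : Function.Injective d) :
    (canonicalFrame (gramForm d hd)).IsGeneratingOrthogonalFrame := by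
  refine ⟨isFrame_canonicalFrame _, isOrthogonal_canonicalFrame d hd, fun X S hS => ?_⟩
  let f := Pi.evalLatticeHom (α := fun _ : Unit => SubspaceMOL (gramForm d hd)) ()
  have hC : ContainsFrames (S.families f) := S.containsFrames_families
    (fun i => hS (Or.inl ⟨i, rfl⟩)) (fun i j hij => hS (Or.inr ⟨i, j, hij, rfl⟩))
  have hC' (Y) (hY : Y ∈ S.families f) : (fun k => (gramForm d hd).form.orthogonal (Y k)) ∈
    S.families f := S.compl_mem hY
  have htop : S.families f = ⊤ := hC.eq_top_of_coordRing_eq_top <|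
    hC.coordRing_eq_top hinj (hC.diagonal_mem_coordRing hC') (hC.vecMulVec_one_mem_coordRing hC')
  exact (htop ▸ Sublattice.mem_top _ : (fun _ => X) ∈ S.families f)

end CanonicalFrame

section Evaluation

open Filter Matrix

/-- The value of a rational function at a rational number; it has the junk value `0` at a pole, so
it is additive and multiplicative only away from the poles. -/
noncomputable def ratEval (a : ℚ) (f : RatFunc ℚ) : ℚ := f.eval (RingHom.id ℚ) a

theorem eventually_eval_denom_ne_zero (f : RatFunc ℚ) :
    ∀ᶠ a : ℚ in atTop, f.denom.eval₂ (RingHom.id ℚ) a ≠ 0 :=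
  Polynomial.eventually_atTop_not_isRoot _ f.denom_ne_zero

theorem eventually_ratEval_add (f g : RatFunc ℚ) :
    ∀ᶠ a in atTop, ratEval a (f + g) = ratEval a f + ratEval a g := by
  filter_upwards [eventually_eval_denom_ne_zero f, eventually_eval_denom_ne_zero g] with a hf hg
  exact RatFunc.eval_add _ _ hf hg

theorem eventually_ratEval_mul (f g : RatFunc ℚ) :
    ∀ᶠ a in atTop, ratEval a (f * g) = ratEval a f * ratEval a g := by
  filter_upwards [eventually_eval_denom_ne_zero f, eventually_eval_denom_ne_zero g] with a hf hg
  exact RatFunc.eval_mul _ _ hf hg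

@[simp] theorem ratEval_zero (a : ℚ) : ratEval a 0 = 0 := RatFunc.eval_zero _ _

@[simp] theorem ratEval_one (a : ℚ) : ratEval a 1 = 1 := RatFunc.eval_one _ _

@[simp] theorem ratEval_X (a : ℚ) : ratEval a RatFunc.X = a := RatFunc.eval_X _ _

@[simp] theorem ratEval_C (a c : ℚ) : ratEval a (RatFunc.C c) = c := RatFunc.eval_C _ _

theorem ratEval_algebraMap (a : ℚ) (p : Polynomial ℚ) :
    ratEval a (algebraMap (Polynomial ℚ) (RatFunc ℚ) p) = p.eval a :=
  RatFunc.eval_algebraMap _ _ p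

theorem eventually_ratEval_ne_zero {f : RatFunc ℚ} (hf : f ≠ 0) :
    ∀ᶠ a in atTop, ratEval a f ≠ 0 := by
  filter_upwards [eventually_ratEval_mul f f⁻¹] with a h h0
  rw [mul_inv_cancel₀ hf, h0, zero_mul, ratEval_one] at h
  exact one_ne_zero h

theorem eventually_ratEval_sum {ι : Type*} (s : Finset ι) (f : ι → RatFunc ℚ) :
    ∀ᶠ a in atTop, ratEval a (∑ i ∈ s, f i) = ∑ i ∈ s, ratEval a (f i) := by
  classical
  induction s using Finset.induction_on with
  | empty => simp
  | insert i s hi ih =>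
    filter_upwards [ih, eventually_ratEval_add (f i) (∑ j ∈ s, f j)] with a h h'
    rw [Finset.sum_insert hi, Finset.sum_insert hi, h', h]

theorem eventually_ratEval_dotProduct {ι : Type*} [Fintype ι] (u v : ι → RatFunc ℚ) :
    ∀ᶠ a in atTop, ratEval a (u ⬝ᵥ v) = (fun i => ratEval a (u i)) ⬝ᵥ fun i => ratEval a (v i) := by
  filter_upwards [eventually_ratEval_sum Finset.univ fun i => u i * v i,
    eventually_all.2 fun i => eventually_ratEval_mul (u i) (v i)] with a hsum hmul
  rw [dotProduct, hsum]
  exact Finset.sum_congr rfl fun i _ => hmul i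

variable {m n p τ κ : Type*}

section Finite

variable [DecidableEq τ]

/-- The value of a matrix of rational functions at the diagonal matrix with entries `d`. -/
noncomputable def evalMatrix (d : τ → ℚ) (M : Matrix m n (RatFunc ℚ)) :
    Matrix (m × τ) (n × τ) ℚ :=
  blockDiagonal fun t => M.map (ratEval (d t))

/-- The value of a vector of rational functions at the vector `d`, taken entrywise in `d`. -/
noncomputable def evalVec (d : τ → ℚ) (u : m → RatFunc ℚ) : m × τ → ℚ :=
  fun p => ratEval (d p.2) (u p.1)

theorem evalMatrix_mulVec_apply [Fintype n] [Fintype τ] (d : τ → ℚ) (M : Matrix m n (RatFunc ℚ))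
    (x : n × τ → ℚ) (i : m) (t : τ) :
    (evalMatrix d M *ᵥ x) (i, t) = (fun j => ratEval (d t) (M i j)) ⬝ᵥ fun j => x (j, t) := by
  simp [evalMatrix, mulVec, dotProduct, Fintype.sum_prod_type, blockDiagonal_apply, ite_mul]

theorem transpose_evalMatrix (d : τ → ℚ) (M : Matrix m n (RatFunc ℚ)) :
    (evalMatrix d M)ᵀ = evalMatrix d Mᵀ := blockDiagonal_transpose _

theorem evalMatrix_zero (d : τ → ℚ) : evalMatrix d (0 : Matrix m n (RatFunc ℚ)) = 0 := by
  simp only [evalMatrix, Matrix.map_zero _ (ratEval_zero _)]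
  exact blockDiagonal_zero

theorem evalMatrix_diagonal [DecidableEq m] (d : τ → ℚ) (f : m → RatFunc ℚ) :
    evalMatrix d (diagonal f) = diagonal fun p => ratEval (d p.2) (f p.1) := by
  simp only [evalMatrix, diagonal_map (ratEval_zero _)]
  exact blockDiagonal_diagonal fun t i => ratEval (d t) (f i)

theorem evalMatrix_one [DecidableEq m] (d : τ → ℚ) :
    evalMatrix d (1 : Matrix m m (RatFunc ℚ)) = 1 := by
  simp only [← diagonal_one, evalMatrix_diagonal, ratEval_one]

end Finite

/-- The entries of the vectors `d k` tend to infinity along `l`, uniformly in their index. -/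
def TendsToInfinity {τ : κ → Type*} (l : Filter κ) (d : ∀ k, τ k → ℚ) : Prop :=
  ∀ a, ∀ᶠ k in l, ∀ t, a ≤ d k t

namespace TendsToInfinity

variable {τ : κ → Type*} {l : Filter κ} {d : ∀ k, τ k → ℚ} (hd : TendsToInfinity l d)

include hd

theorem eventually_forall {q : ℚ → Prop} (hq : ∀ᶠ a in atTop, q a) :
    ∀ᶠ k in l, ∀ t, q (d k t) := by
  obtain ⟨N, hN⟩ := eventually_atTop.1 hq
  exact (hd N).mono fun k hk t => hN _ (hk t)

variable [∀ k, DecidableEq (τ k)] [Finite m] [Finite n]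

theorem evalMatrix_add (M N : Matrix m n (RatFunc ℚ)) :
    ∀ᶠ k in l, evalMatrix (d k) (M + N) = evalMatrix (d k) M + evalMatrix (d k) N := by
  filter_upwards [eventually_all.2 fun i => eventually_all.2 fun j =>
    hd.eventually_forall (eventually_ratEval_add (M i j) (N i j))] with k hk
  rw [evalMatrix, evalMatrix, evalMatrix, ← blockDiagonal_add]
  exact congrArg _ (funext fun t => Matrix.ext fun i j => hk i j t)

theorem evalMatrix_mul [Fintype p] [∀ k, Fintype (τ k)] (M : Matrix m p (RatFunc ℚ))
    (N : Matrix p n (RatFunc ℚ)) :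
    ∀ᶠ k in l, evalMatrix (d k) (M * N) = evalMatrix (d k) M * evalMatrix (d k) N := by
  filter_upwards [eventually_all.2 fun i => eventually_all.2 fun j =>
    hd.eventually_forall (eventually_ratEval_dotProduct (M i) fun l => N l j)] with k hk
  rw [evalMatrix, evalMatrix, evalMatrix, ← blockDiagonal_mul]
  exact congrArg _ (funext fun t => Matrix.ext fun i j => hk i j t)

theorem evalMatrix_mulVec_evalVec [Fintype p] [∀ k, Fintype (τ k)] (M : Matrix m p (RatFunc ℚ))
    (u : p → RatFunc ℚ) :
    ∀ᶠ k in l, evalMatrix (d k) M *ᵥ evalVec (d k) u = evalVec (d k) (M *ᵥ u) := by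
  filter_upwards [eventually_all.2 fun i =>
    hd.eventually_forall (eventually_ratEval_dotProduct (M i) u)] with k hk
  ext ⟨i, t⟩
  rw [evalMatrix_mulVec_apply]
  exact (hk i t).symm

end TendsToInfinity

end Evaluation

section Sandwich

open Filter Matrix

theorem exists_mul_mul_eq {m n K : Type*} [Field K] [Fintype m] [Fintype n]
    (M : Matrix m n K) : ∃ Q : Matrix n m K, M * Q * M = M := by
  classical
  let f := toLin' M
  obtain ⟨p, hp⟩ := LinearMap.exists_leftInverse_of_injective (LinearMap.range f).subtype
    (Submodule.ker_subtype _)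
  obtain ⟨q, hq⟩ := Module.projective_lifting_property f.rangeRestrict p f.surjective_rangeRestrict
  refine ⟨LinearMap.toMatrix' q, toLin'.injective (LinearMap.ext fun x => ?_)⟩
  simp only [toLin'_mul, toLin'_toMatrix', LinearMap.comp_apply]
  exact congrArg Subtype.val ((LinearMap.congr_fun hq (f x)).trans
    (LinearMap.congr_fun hp (f.rangeRestrict x)))

theorem exists_mul_add_mul_eq {m K : Type*} [Field K] [Fintype m] (M N : Matrix m m K) :
    ∃ A B : Matrix m m K, (M * A + N * B) * M = M ∧ (M * A + N * B) * N = N := by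
  obtain ⟨Q, hQ⟩ := exists_mul_mul_eq (fromCols M N)
  refine ⟨Q.toRows₁, Q.toRows₂, fromCols_inj.eq_iff.1 ?_⟩
  rw [← fromCols_mul_fromRows, fromRows_toRows, ← mul_fromCols, hQ]

section Dot

variable {ι : Type*} [Fintype ι] [DecidableEq ι]

/-- The standard scalar product. -/
def dotForm (ι : Type*) [Fintype ι] [DecidableEq ι] : PosDefForm ι :=
  PosDefForm.ofMatrix 1 PosDef.one

theorem mem_orthogonal_dotForm {V : Submodule ℚ (ι → ℚ)} {x : ι → ℚ} :
    x ∈ (dotForm ι).form.orthogonal V ↔ ∀ y ∈ V, y ⬝ᵥ x = 0 := by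
  simp only [LinearMap.BilinForm.mem_orthogonal_iff, dotForm, PosDefForm.ofMatrix_form_apply,
    one_mulVec]

theorem orthogonal_ofMatrix {G : Matrix ι ι ℚ} (hG : G.PosDef) (V : Submodule ℚ (ι → ℚ)) :
    (PosDefForm.ofMatrix G hG).form.orthogonal V =
      ((dotForm ι).form.orthogonal V).comap G.mulVecLin := by
  ext x
  rw [Submodule.mem_comap, mem_orthogonal_dotForm]
  simp only [LinearMap.BilinForm.mem_orthogonal_iff, PosDefForm.ofMatrix_form_apply,
    mulVecLin_apply]

theorem mem_orthogonal_span {s : Set (ι → ℚ)} {x : ι → ℚ} :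
    x ∈ (dotForm ι).form.orthogonal (Submodule.span ℚ s) ↔ ∀ u ∈ s, u ⬝ᵥ x = 0 := by
  rw [mem_orthogonal_dotForm]
  refine ⟨fun h u hu => h u (Submodule.subset_span hu), fun h y hy => ?_⟩
  induction hy using Submodule.span_induction with
  | mem u hu => exact h u hu
  | zero => exact zero_dotProduct x
  | add u v _ _ hu hv => rw [add_dotProduct, hu, hv, add_zero]
  | smul c u _ hu => rw [smul_dotProduct, hu, smul_zero]

theorem orthogonal_range_mulVecLin (M : Matrix ι ι ℚ) :
    (dotForm ι).form.orthogonal (LinearMap.range M.mulVecLin) = LinearMap.ker Mᵀ.mulVecLin := by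
  ext x
  rw [mem_orthogonal_dotForm, LinearMap.mem_ker, mulVecLin_apply, ← dotProduct_eq_zero_iff]
  simp only [LinearMap.mem_range, forall_exists_index, forall_apply_eq_imp_iff, mulVecLin_apply]
  exact forall_congr' fun y => by
    rw [dotProduct_comm _ y, dotProduct_mulVec, vecMul_transpose]

theorem ker_mulVecLin_eq_range {M N Q : Matrix ι ι ℚ} (h : M * N = 0) (h' : N + Q * M = 1) :
    LinearMap.ker M.mulVecLin = LinearMap.range N.mulVecLin := by
  refine le_antisymm ?_ ?_
  · refine fun x hx => ⟨x, ?_⟩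
    have hx' : M *ᵥ x = 0 := hx
    calc N.mulVecLin x = (N + Q * M) *ᵥ x := by
          rw [add_mulVec, ← mulVec_mulVec, hx', mulVec_zero, add_zero, mulVecLin_apply]
      _ = x := by rw [h', one_mulVec]
  · rintro _ ⟨x, rfl⟩
    rw [LinearMap.mem_ker, mulVecLin_apply, mulVecLin_apply, mulVec_mulVec, h, zero_mulVec]

end Dot

section Finite

variable {m τ : Type*}

/-- The span of the values of a set of vectors of rational functions. -/
noncomputable def evalSpan (d : τ → ℚ) (s : Set (m → RatFunc ℚ)) : Submodule ℚ (m × τ → ℚ) :=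
  Submodule.span ℚ (evalVec d '' s)

theorem evalSpan_mono (d : τ → ℚ) {s r : Set (m → RatFunc ℚ)} (h : s ⊆ r) :
    evalSpan d s ≤ evalSpan d r := Submodule.span_mono (Set.image_mono h)

variable [Fintype m] [Fintype τ] [DecidableEq τ]

/-- The column space of the value of a matrix of rational functions. -/
noncomputable def evalRange (d : τ → ℚ) (M : Matrix m m (RatFunc ℚ)) : Submodule ℚ (m × τ → ℚ) :=
  LinearMap.range (evalMatrix d M).mulVecLin

theorem mem_orthogonal_evalSpan [DecidableEq m] {d : τ → ℚ} {s : Set (m → RatFunc ℚ)}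
    {x : m × τ → ℚ} :
    x ∈ (dotForm _).form.orthogonal (evalSpan d s) ↔ ∀ u ∈ s, evalVec d u ⬝ᵥ x = 0 := by
  rw [evalSpan, mem_orthogonal_span, Set.forall_mem_image]

end Finite

variable {m κ : Type*} [Fintype m] [DecidableEq m]

variable {τ : κ → Type*} [∀ k, Fintype (τ k)] [∀ k, DecidableEq (τ k)] {l : Filter κ}
  {d : ∀ k, τ k → ℚ} {X Y : ∀ k, Submodule ℚ (m × τ k → ℚ)}

/-- A family of subspaces of `ℚ^(mτ)` that is, up to the values of finitely many vectors of rational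
functions, the family of column spaces of the values of one matrix of rational functions. -/
def IsSandwiched (l : Filter κ) (d : ∀ k, τ k → ℚ) (X : ∀ k, Submodule ℚ (m × τ k → ℚ)) : Prop :=
  ∃ (M : Matrix m m (RatFunc ℚ)) (s : Set (m → RatFunc ℚ)), s.Finite ∧ ∀ᶠ k in l,
    evalRange (d k) M ⊓ (dotForm _).form.orthogonal (evalSpan (d k) s) ≤ X k ∧
      X k ≤ evalRange (d k) M ⊔ evalSpan (d k) s

theorem isSandwiched_evalRange (M : Matrix m m (RatFunc ℚ)) :
    IsSandwiched l d fun k => evalRange (d k) M :=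
  ⟨M, ∅, Set.finite_empty, Eventually.of_forall fun _ => ⟨inf_le_left, le_sup_left⟩⟩

theorem isSandwiched_bot : IsSandwiched (m := m) l d fun _ => ⊥ := by
  simpa only [evalRange, evalMatrix_zero, mulVecLin_zero, LinearMap.range_zero] using
    isSandwiched_evalRange (d := d) (l := l) (0 : Matrix m m (RatFunc ℚ))

theorem isSandwiched_graphSub_smul_one (i j : m) (c : ℚ) :
    IsSandwiched l d fun _ => graphSub i j (c • 1) := by
  convert isSandwiched_evalRange (d := d) (l := l)
    ((single i i 1 - single j i c : Matrix m m ℚ).map RatFunc.C) with k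
  let f := blockIncl i - blockIncl j ∘ₗ (c • 1 : Matrix (τ k) (τ k) ℚ).mulVecLin
  have h : (evalMatrix (d k) ((single i i 1 - single j i c).map RatFunc.C)).mulVecLin =
      f ∘ₗ blockProj i := by
    refine LinearMap.ext fun x => funext fun ⟨a, t⟩ => ?_
    simp only [mulVecLin_apply, evalMatrix_mulVec_apply, map_apply, ratEval_C]
    simp [f, dotProduct, sub_mul, blockProj_apply, blockIncl_apply, single_apply, ite_and,
      eq_comm (a := a), ite_mul]
  rw [evalRange, h, LinearMap.range_comp_of_range_eq_top]
  · rfl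
  · exact LinearMap.range_eq_top.2 fun u => ⟨blockIncl i u, blockProj_blockIncl_self i u⟩

namespace TendsToInfinity

variable (hd : TendsToInfinity l d)

include hd

omit [DecidableEq m] in
theorem evalMatrix_mulVec_evalVec_of_finite (M : Matrix m m (RatFunc ℚ))
    {s : Set (m → RatFunc ℚ)} (hs : s.Finite) :
    ∀ᶠ k in l, ∀ u ∈ s, evalMatrix (d k) M *ᵥ evalVec (d k) u = evalVec (d k) (M *ᵥ u) :=
  (eventually_all_finite hs).2 fun u _ => hd.evalMatrix_mulVec_evalVec M u

theorem mulVec_mem_orthogonal_evalSpan (M : Matrix m m (RatFunc ℚ)) {s : Set (m → RatFunc ℚ)}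
    (hs : s.Finite) :
    ∀ᶠ k in l, ∀ x ∈ (dotForm _).form.orthogonal (evalSpan (d k) (Mᵀ.mulVec '' s)),
      evalMatrix (d k) M *ᵥ x ∈ (dotForm _).form.orthogonal (evalSpan (d k) s) := by
  filter_upwards [hd.evalMatrix_mulVec_evalVec_of_finite Mᵀ hs] with k hk x hx
  refine mem_orthogonal_evalSpan.2 fun u hu => ?_
  rw [dotProduct_mulVec, ← mulVec_transpose, transpose_evalMatrix, hk u hu]
  exact mem_orthogonal_evalSpan.1 hx _ ⟨u, hu, rfl⟩

omit [DecidableEq m] in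
theorem evalRange_mul_le (M N : Matrix m m (RatFunc ℚ)) :
    ∀ᶠ k in l, evalRange (d k) (M * N) ≤ evalRange (d k) M := by
  filter_upwards [hd.evalMatrix_mul M N] with k hk
  rw [evalRange, hk, mulVecLin_mul]
  exact LinearMap.range_comp_le_range _ _

omit [DecidableEq m] in
theorem mulVec_mem_evalSpan (M : Matrix m m (RatFunc ℚ)) {s : Set (m → RatFunc ℚ)}
    (hs : s.Finite) :
    ∀ᶠ k in l, ∀ x ∈ evalSpan (d k) s,
      evalMatrix (d k) M *ᵥ x ∈ evalSpan (d k) (M.mulVec '' s) := by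
  filter_upwards [hd.evalMatrix_mulVec_evalVec_of_finite M hs] with k hk
  suffices evalSpan (d k) s ≤
      (evalSpan (d k) (M.mulVec '' s)).comap (evalMatrix (d k) M).mulVecLin from this
  refine Submodule.span_le.2 ?_
  rintro _ ⟨u, hu, rfl⟩
  exact Submodule.subset_span ⟨_, ⟨u, hu, rfl⟩, (hk u hu).symm⟩

theorem isSandwiched_sup (hX : IsSandwiched l d X) (hY : IsSandwiched l d Y) :
    IsSandwiched l d fun k => X k ⊔ Y k := by
  obtain ⟨M, s, hs, hX⟩ := hX
  obtain ⟨N, r, hr, hY⟩ := hY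
  obtain ⟨A, B, hM, hN⟩ := exists_mul_add_mul_eq M N
  have hP : (M * A + N * B) * (M * A + N * B) = M * A + N * B := by
    rw [mul_add, ← mul_assoc, ← mul_assoc, hM, hN]
  refine ⟨M * A + N * B, (s ∪ r) ∪ ((M * A)ᵀ.mulVec '' s ∪ (N * B)ᵀ.mulVec '' r),
    (hs.union hr).union ((hs.image _).union (hr.image _)), ?_⟩
  filter_upwards [hX, hY, hd.evalMatrix_add (M * A) (N * B),
    hM ▸ hd.evalRange_mul_le (M * A + N * B) M, hN ▸ hd.evalRange_mul_le (M * A + N * B) N,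
    hd.evalRange_mul_le M A, hd.evalRange_mul_le N B,
    hP ▸ hd.evalMatrix_mul (M * A + N * B) (M * A + N * B),
    hd.mulVec_mem_orthogonal_evalSpan (M * A) hs,
    hd.mulVec_mem_orthogonal_evalSpan (N * B) hr] with k hX hY hadd hMP hNP hMA hNB hPP hxs hxr
  refine ⟨?_, sup_le (hX.2.trans ?_) (hY.2.trans ?_)⟩
  · rintro x ⟨⟨y, hy⟩, hx⟩
    have hPx : evalMatrix (d k) (M * A) *ᵥ x + evalMatrix (d k) (N * B) *ᵥ x = x := by
      rw [← add_mulVec, ← hadd, ← hy, mulVecLin_apply, mulVec_mulVec, ← hPP]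
    have hx' := mem_orthogonal_evalSpan.1 hx
    rw [← hPx]
    refine add_mem (Submodule.mem_sup_left (hX.1 ⟨hMA ⟨x, rfl⟩, hxs x ?_⟩))
      (Submodule.mem_sup_right (hY.1 ⟨hNB ⟨x, rfl⟩, hxr x ?_⟩))
    · exact mem_orthogonal_evalSpan.2 fun u hu => hx' u (Or.inr (Or.inl hu))
    · exact mem_orthogonal_evalSpan.2 fun u hu => hx' u (Or.inr (Or.inr hu))
  · exact sup_le_sup hMP (evalSpan_mono _ (Set.subset_union_left.trans Set.subset_union_left))
  · exact sup_le_sup hNP (evalSpan_mono _ (Set.subset_union_right.trans Set.subset_union_left))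

theorem isSandwiched_orthogonal_dotForm (hX : IsSandwiched l d X) :
    IsSandwiched l d fun k => (dotForm _).form.orthogonal (X k) := by
  obtain ⟨M, s, hs, hX⟩ := hX
  obtain ⟨Q, hQ⟩ := exists_mul_mul_eq Mᵀ
  have hzero : Mᵀ * (1 - Q * Mᵀ) = 0 := by rw [mul_sub, mul_one, ← mul_assoc, hQ, sub_self]
  have hone : 1 - Q * Mᵀ + Q * Mᵀ = 1 := sub_add_cancel _ _
  refine ⟨1 - Q * Mᵀ, s, hs, ?_⟩
  filter_upwards [hX, hzero ▸ hd.evalMatrix_mul Mᵀ (1 - Q * Mᵀ), hd.evalMatrix_mul Q Mᵀ,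
    hone ▸ hd.evalMatrix_add (1 - Q * Mᵀ) (Q * Mᵀ)] with k hX hzero hQM hone
  have hrange : evalRange (d k) (1 - Q * Mᵀ) =
      (dotForm _).form.orthogonal (evalRange (d k) M) := by
    rw [evalRange, evalRange, orthogonal_range_mulVecLin, transpose_evalMatrix]
    refine (ker_mulVecLin_eq_range (Q := evalMatrix (d k) Q)
      (hzero.symm.trans (evalMatrix_zero _)) ?_).symm
    rw [← hQM, ← hone, evalMatrix_one]
  let S := SubspaceMOL (dotForm (m × τ k))
  rw [hrange]
  constructor
  · exact (ModularOrtholattice.compl_sup' (L := S) _ _).ge.trans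
      (LinearMap.BilinForm.orthogonal_le hX.2)
  · refine (LinearMap.BilinForm.orthogonal_le hX.1).trans
      ((ModularOrtholattice.compl_inf' (L := S) _ _).le.trans ?_)
    exact sup_le_sup_left (PosDefForm.orthogonal_orthogonal _ _).le _

end TendsToInfinity

section Gram

variable {X : ∀ k, Submodule ℚ (Fin 3 × τ k → ℚ)}

theorem gramMatrix_eq_evalMatrix_add {τ : Type*} [DecidableEq τ] (d : τ → ℚ) :
    gramMatrix d = evalMatrix d (diagonal ![1, RatFunc.X, 1]) +
      vecMulVec (evalVec d (Pi.single 2 1)) (evalVec d (Pi.single 2 1)) := by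
  have hdiag : evalMatrix d (diagonal ![1, RatFunc.X, 1]) =
      diagonal fun p => ![1, d p.2, 1] p.1 := by
    rw [evalMatrix_diagonal]
    congr! 2 with ⟨i, t⟩
    fin_cases i <;> simp
  have hvec : evalVec d (Pi.single (2 : Fin 3) 1) = blockIncl 2 1 := by
    ext ⟨i, t⟩
    fin_cases i <;> simp [evalVec, blockIncl_apply]
  rw [hdiag, hvec, gramMatrix]

theorem TendsToInfinity.isSandwiched_comap_gramMatrix (hd : TendsToInfinity l d)
    (hX : IsSandwiched l d X) :
    IsSandwiched l d fun k => (X k).comap (gramMatrix (d k)).mulVecLin := by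
  obtain ⟨M, s, hs, hX⟩ := hX
  let D : Matrix (Fin 3) (Fin 3) (RatFunc ℚ) := diagonal ![1, RatFunc.X, 1]
  let E := D⁻¹
  let w : Fin 3 → RatFunc ℚ := Pi.single 2 1
  have hD : IsUnit D.det := by simp [D, Fin.prod_univ_three, RatFunc.X_ne_zero]
  have hED : E * D = 1 := nonsing_inv_mul D hD
  have hDEM : D * (E * M) = M := mul_nonsing_inv_cancel_left D M hD
  refine ⟨E * M, insert w (Dᵀ.mulVec '' s ∪ E.mulVec '' insert w s),
    ((hs.image _).union ((hs.insert w).image _)).insert w, ?_⟩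
  filter_upwards [hX, hDEM ▸ hd.evalMatrix_mul D (E * M), hED ▸ hd.evalMatrix_mul E D,
    hd.evalMatrix_mul E M, hd.mulVec_mem_orthogonal_evalSpan D hs,
    hd.mulVec_mem_evalSpan E (hs.insert w)] with k hX hDEM hED hEM hDs hEs
  have hgram (x : Fin 3 × τ k → ℚ) : gramMatrix (d k) *ᵥ x =
      evalMatrix (d k) D *ᵥ x + (evalVec (d k) w ⬝ᵥ x) • evalVec (d k) w := by
    rw [gramMatrix_eq_evalMatrix_add, add_mulVec, vecMulVec_mulVec, op_smul_eq_smul]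
  constructor
  · rintro _ ⟨⟨y, rfl⟩, hx⟩
    have hx' := mem_orthogonal_evalSpan.1 hx
    rw [Submodule.mem_comap, mulVecLin_apply, hgram, hx' w (Or.inl rfl), zero_smul, add_zero]
    refine hX.1 ⟨⟨y, ?_⟩, hDs _ (mem_orthogonal_evalSpan.2 fun u hu => hx' u (Or.inr (Or.inl hu)))⟩
    rw [mulVecLin_apply, mulVecLin_apply, mulVec_mulVec, ← hDEM]
  · intro x hx
    obtain ⟨_, ⟨y, rfl⟩, v, hv, hyv⟩ := Submodule.mem_sup.1 (hX.2 hx)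
    rw [mulVecLin_apply, mulVecLin_apply, hgram] at hyv
    set c := evalVec (d k) w ⬝ᵥ x
    have hx_eq : evalMatrix (d k) (E * M) *ᵥ y + evalMatrix (d k) E *ᵥ (v - c • evalVec (d k) w) =
        x := by
      rw [hEM, ← mulVec_mulVec, ← mulVec_add, ← add_sub_assoc, hyv, add_sub_cancel_right,
        mulVec_mulVec, ← hED, evalMatrix_one, one_mulVec]
    rw [← hx_eq]
    refine add_mem (Submodule.mem_sup_left ⟨y, rfl⟩) (Submodule.mem_sup_right ?_)
    refine evalSpan_mono _ (Set.subset_union_right.trans (Set.subset_insert _ _)) (hEs _ ?_)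
    exact sub_mem (evalSpan_mono _ (Set.subset_insert _ _) hv)
      (Submodule.smul_mem _ _ (Submodule.subset_span ⟨w, Or.inl rfl, rfl⟩))

theorem TendsToInfinity.isSandwiched_orthogonal_gramForm (hd : TendsToInfinity l d)
    (hpos : ∀ k t, 0 < d k t) (hX : IsSandwiched l d X) :
    IsSandwiched l d fun k => (gramForm (d k) (hpos k)).form.orthogonal (X k) := by
  simpa only [gramForm, orthogonal_ofMatrix] using
    hd.isSandwiched_comap_gramMatrix (hd.isSandwiched_orthogonal_dotForm hX)

end Gram

end Sandwich

section Faithful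

open Filter Matrix

variable {κ : Type*} {τ : κ → Type*} [∀ k, Fintype (τ k)] [∀ k, DecidableEq (τ k)] {l : Filter κ}
  {d : ∀ k, τ k → ℚ} {hpos : ∀ k t, 0 < d k t} {X : ∀ k, Submodule ℚ (Fin 3 × τ k → ℚ)}

theorem eventually_pow_dotProduct_eq_zero
    (hX : ∀ i j, ∀ᶠ k in l, ∀ x ∈ X k, (gramForm (d k) (hpos k)).form (blockIncl i (d k ^ j)) x = 0)
    (i : Fin 3) (j : ℕ) : ∀ᶠ k in l, ∀ x ∈ X k, (d k ^ (j + 1)) ⬝ᵥ blockProj i x = 0 := by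
  simp only [gramForm_blockIncl] at hX
  match i with
  | 0 => simpa [gramBlock] using hX 0 (j + 1)
  | 1 =>
    filter_upwards [hX 1 j] with k h x hx
    rw [← h x hx, dotProduct_mulVec, pow_succ]
    congr 1
    ext t
    simp [gramBlock, vecMul_diagonal]
  | 2 =>
    have hblock (k) (u y : τ k → ℚ) :
        u ⬝ᵥ gramBlock (d k) 2 *ᵥ y = u ⬝ᵥ y + (u ⬝ᵥ 1) * (1 ⬝ᵥ y) := by
      simp [-vecMulVec_one, -one_vecMulVec, gramBlock, add_mulVec, vecMulVec_mulVec, mul_comm]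
    filter_upwards [hX 2 0, hX 2 (j + 1)] with k h0 hj x hx
    have hsum : (1 : τ k → ℚ) ⬝ᵥ blockProj 2 x = 0 := by
      have h := h0 x hx
      rw [pow_zero, hblock, ← one_add_mul] at h
      refine (mul_eq_zero.1 h).resolve_left ?_
      rw [one_dotProduct_one]
      positivity
    rw [← hj x hx, hblock, hsum, mul_zero, add_zero]

omit [∀ k, DecidableEq (τ k)] in
theorem eventually_aeval_dotProduct_eq_zero {i : Fin 3}
    (hX : ∀ j, ∀ᶠ k in l, ∀ x ∈ X k, (d k ^ (j + 1)) ⬝ᵥ blockProj i x = 0) (N : ℕ) :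
    ∀ᶠ k in l, ∀ p ∈ Polynomial.degreeLT ℚ N, ∀ x ∈ X k,
      Polynomial.aeval (d k) (Polynomial.X * p) ⬝ᵥ blockProj i x = 0 := by
  classical
  filter_upwards [(eventually_all_finset (Finset.range N)).2 fun j _ => hX j] with k hk p hp x hx
  rw [Polynomial.degreeLT_eq_span_X_pow] at hp
  induction hp using Submodule.span_induction with
  | mem p hp =>
    obtain ⟨j, hj, rfl⟩ := Finset.mem_image.1 hp
    simpa [pow_succ'] using hk j hj x hx
  | zero => simp
  | add p q _ _ hp hq => rw [mul_add, map_add, add_dotProduct, hp, hq, add_zero]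
  | smul c p _ hp => rw [mul_smul_comm, map_smul, smul_dotProduct, hp, smul_zero]

theorem exists_common_denominator {m : Type*} [Finite m] {s : Set (m → RatFunc ℚ)}
    (hs : s.Finite) :
    ∃ g : Polynomial ℚ, g ≠ 0 ∧ ∀ u ∈ s, ∀ i, ∃ p : Polynomial ℚ,
      algebraMap _ (RatFunc ℚ) g * u i = algebraMap _ _ p := by
  have := Fintype.ofFinite m
  obtain ⟨b, hb⟩ := IsLocalization.exist_integer_multiples (nonZeroDivisors (Polynomial ℚ))
    (hs.toFinset ×ˢ (Finset.univ : Finset m)) fun q => (q.1 q.2 : RatFunc ℚ)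
  refine ⟨b, nonZeroDivisors.coe_ne_zero b, fun u hu i => ?_⟩
  obtain ⟨p, hp⟩ := hb (u, i) (by simp [hu])
  exact ⟨p, by rw [hp, Algebra.smul_def]⟩

theorem eq_zero_of_aeval_eq_zero {τ : Type*} [Fintype τ] {d : τ → ℚ}
    (hinj : Function.Injective d) {p : Polynomial ℚ}
    (hp : p ∈ Polynomial.degreeLT ℚ (Fintype.card τ)) (h : Polynomial.aeval d p = 0) : p = 0 := by
  refine Polynomial.eq_zero_of_degree_lt_of_eval_index_eq_zero Finset.univ hinj.injOn
    (by simpa [Polynomial.mem_degreeLT] using hp) fun t _ => ?_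
  simpa [Polynomial.aeval_pi_apply₂, Polynomial.coe_aeval_eq_eval] using congrFun h t

theorem exists_mem_degreeLT_mem_orthogonal_evalSpan {m τ : Type*} [Fintype m] [DecidableEq m]
    [Fintype τ] [DecidableEq τ] (d : τ → ℚ) {s : Set (m → RatFunc ℚ)} (hs : s.Finite)
    (F : Polynomial ℚ →ₗ[ℚ] (m × τ → ℚ)) :
    ∃ p ∈ Polynomial.degreeLT ℚ (s.ncard + 1), p ≠ 0 ∧
      F p ∈ (dotForm _).form.orthogonal (evalSpan d s) := by
  have := hs.fintype
  let G : Polynomial.degreeLT ℚ (s.ncard + 1) →ₗ[ℚ] s → ℚ :=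
    LinearMap.pi (fun u => dotProductBilin ℚ ℚ (evalVec d u.1)) ∘ₗ F ∘ₗ Submodule.subtype _
  have hG : LinearMap.ker G ≠ ⊥ := LinearMap.ker_ne_bot_of_finrank_lt (by
    rw [(Polynomial.degreeLTEquiv ℚ _).finrank_eq]
    simp)
  obtain ⟨p, hp, hp0⟩ := Submodule.exists_mem_ne_zero_of_ne_bot hG
  exact ⟨p, p.2, fun h => hp0 (Subtype.ext h),
    mem_orthogonal_evalSpan.2 fun u hu => congrFun (LinearMap.mem_ker.1 hp) ⟨u, hu⟩⟩

theorem eq_zero_of_evalRange_inf_orthogonal_le {m : Type*} [Fintype m] [DecidableEq m] [l.NeBot]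
    {X : ∀ k, Submodule ℚ (m × τ k → ℚ)} (hd : TendsToInfinity l d)
    (hinj : ∀ k, Function.Injective (d k)) (hcard : Tendsto (fun k => Fintype.card (τ k)) l atTop)
    {M : Matrix m m (RatFunc ℚ)} {s : Set (m → RatFunc ℚ)} (hs : s.Finite)
    (hM : ∀ᶠ k in l, evalRange (d k) M ⊓ (dotForm _).form.orthogonal (evalSpan (d k) s) ≤ X k)
    (hX : ∀ i N, ∀ᶠ k in l, ∀ p ∈ Polynomial.degreeLT ℚ N, ∀ x ∈ X k,
      Polynomial.aeval (d k) (Polynomial.X * p) ⬝ᵥ blockProj i x = 0) : M = 0 := by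
  ext a b
  by_contra hab
  obtain ⟨k, hM, hX, hcard, hpos, hne⟩ := (hM.and ((hX a (s.ncard + 1)).and
    ((hcard.eventually_ge_atTop (s.ncard + 1)).and ((hd.eventually_forall
      (eventually_gt_atTop 0)).and (hd.eventually_forall
        (eventually_ratEval_ne_zero hab)))))).exists
  let f : τ k → ℚ := fun t => ratEval (d k t) (M a b)
  let H : Polynomial ℚ →ₗ[ℚ] τ k → ℚ := LinearMap.mulLeft ℚ f ∘ₗ
    (Polynomial.aeval (d k)).toLinearMap ∘ₗ LinearMap.mulLeft ℚ Polynomial.X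
  obtain ⟨p, hp, hp0, hpx⟩ := exists_mem_degreeLT_mem_orthogonal_evalSpan (d k) hs
    ((evalMatrix (d k) M).mulVecLin ∘ₗ blockIncl b ∘ₗ H)
  have hproj : blockProj a (evalMatrix (d k) M *ᵥ blockIncl b (H p)) = f * H p := by
    ext t
    simp [blockProj_apply, evalMatrix_mulVec_apply, blockIncl_apply, dotProduct, f]
  have hH : H p = 0 := by
    have h := hproj ▸ hX p hp _ (hM ⟨⟨blockIncl b (H p), rfl⟩, hpx⟩)
    refine dotProduct_self_eq_zero.1 (Eq.trans ?_ h)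
    exact Finset.sum_congr rfl fun t _ => by simp [H]; ring
  refine hp0 (eq_zero_of_aeval_eq_zero (hinj k) (Polynomial.degreeLT_mono hcard hp) ?_)
  ext t
  have ht : f t * (d k t * Polynomial.aeval (d k) p t) = 0 := by simpa [H] using congrFun hH t
  exact ((mul_eq_zero.1 ht).resolve_left (hne t) |> mul_eq_zero.1).resolve_left (hpos t).ne'

omit [∀ k, DecidableEq (τ k)] in
theorem eventually_eq_bot_of_le_evalSpan {m : Type*} [Finite m]
    {X : ∀ k, Submodule ℚ (m × τ k → ℚ)} (hd : TendsToInfinity l d)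
    {s : Set (m → RatFunc ℚ)} (hs : s.Finite) (hle : ∀ᶠ k in l, X k ≤ evalSpan (d k) s)
    (hX : ∀ i (p : Polynomial ℚ), ∀ᶠ k in l, ∀ x ∈ X k,
      Polynomial.aeval (d k) (Polynomial.X * p) ⬝ᵥ blockProj i x = 0) :
    ∀ᶠ k in l, X k = ⊥ := by
  classical
  have := Fintype.ofFinite m
  obtain ⟨g, hg, hgs⟩ := exists_common_denominator hs
  have horth : ∀ᶠ k in l, ∀ u ∈ s, ∀ x ∈ X k,
      evalVec (d k) u ⬝ᵥ (diagonal fun p => d k p.2 * g.eval (d k p.2) ^ 2) *ᵥ x = 0 := by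
    refine (eventually_all_finite hs).2 fun u hu => ?_
    choose p hp using hgs u hu
    filter_upwards [eventually_all.2 fun i => hX i (g * p i), eventually_all.2 fun i =>
      hd.eventually_forall (eventually_ratEval_mul (algebraMap _ _ g) (u i))] with k hX hgu x hx
    rw [dotProduct, Fintype.sum_prod_type]
    refine Finset.sum_eq_zero fun i _ => Eq.trans (Finset.sum_congr rfl fun t _ => ?_) (hX i x hx)
    have hgp := hgu i t
    rw [hp, ratEval_algebraMap, ratEval_algebraMap] at hgp
    simp only [evalVec, mulVec_diagonal, blockProj_apply, Polynomial.aeval_pi_apply₂,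
      Polynomial.coe_aeval_eq_eval, Polynomial.eval_mul, Polynomial.eval_X, hgp]
    ring
  filter_upwards [hle, horth, hd.eventually_forall (eventually_gt_atTop 0),
    hd.eventually_forall (Polynomial.eventually_atTop_not_isRoot g hg)] with k hle horth hpos hne
  have hw : (diagonal fun p : m × τ k => d k p.2 * g.eval (d k p.2) ^ 2).PosDef :=
    PosDef.diagonal fun p => mul_pos (hpos p.2) (sq_pos_of_ne_zero (hne p.2))
  refine eq_bot_iff.2 ((le_inf hle fun x hx => ?_).trans
    ((PosDefForm.ofMatrix _ hw).inf_orthogonal (evalSpan (d k) s)).le)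
  rw [orthogonal_ofMatrix, Submodule.mem_comap, mem_orthogonal_evalSpan]
  exact fun u hu => horth u hu x hx

theorem IsSandwiched.eventually_eq_bot [l.NeBot] (hXs : IsSandwiched l d X)
    (hd : TendsToInfinity l d) (hinj : ∀ k, Function.Injective (d k))
    (hcard : Tendsto (fun k => Fintype.card (τ k)) l atTop)
    (hX : ∀ i j, ∀ᶠ k in l, ∀ x ∈ X k,
      (gramForm (d k) (hpos k)).form (blockIncl i (d k ^ j)) x = 0) :
    ∀ᶠ k in l, X k = ⊥ := by
  obtain ⟨M, s, hs, hXs⟩ := hXs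
  have hX' (i) := eventually_aeval_dotProduct_eq_zero (eventually_pow_dotProduct_eq_zero hX i)
  obtain rfl := eq_zero_of_evalRange_inf_orthogonal_le hd hinj hcard hs
    (hXs.mono fun _ h => h.1) hX'
  refine eventually_eq_bot_of_le_evalSpan hd hs ?_ fun i p => ?_
  · filter_upwards [hXs] with k hk
    simpa [evalRange, evalMatrix_zero] using hk.2
  · exact (hX' i (p.natDegree + 1)).mono fun k hk => hk p
      (Polynomial.mem_degreeLT.2 (Polynomial.degree_lt_iff_coeff_zero _ _ |>.2 fun m hm =>
        Polynomial.coeff_eq_zero_of_natDegree_lt hm))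

end Faithful

section Ultraproduct

open Filter Matrix

/-- A subset closed under joins and complements, as a subalgebra. -/
def SubMOL.ofSupCompl {L : Type*} [ModularOrtholattice L] (s : Set L) (bot_mem : ⊥ ∈ s)
    (sup_mem : ∀ {x y}, x ∈ s → y ∈ s → x ⊔ y ∈ s) (compl_mem : ∀ {x}, x ∈ s → xᶜ ∈ s) :
    SubMOL L where
  carrier := s
  bot_mem := bot_mem
  top_mem := ModularOrtholattice.compl_bot' (L := L) ▸ compl_mem bot_mem
  sup_mem := sup_mem
  inf_mem {x y} hx hy := ModularOrtholattice.compl_sup_compl x y ▸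
    compl_mem (sup_mem (compl_mem hx) (compl_mem hy))
  compl_mem := compl_mem

theorem PosDefForm.span_singleton_inf_orthogonal_eq_bot {ι : Type*} (Φ : PosDefForm ι)
    {a y : ι → ℚ} {Y : Submodule ℚ (ι → ℚ)} (hy : y ∈ Y) (h : Φ.form y a ≠ 0) :
    Submodule.span ℚ {a} ⊓ Φ.form.orthogonal Y = ⊥ := by
  rw [eq_bot_iff]
  rintro x ⟨hx, hxY⟩
  obtain ⟨c, rfl⟩ := Submodule.mem_span_singleton.1 hx
  have h0 : c * Φ.form y a = 0 := by simpa only [map_smul, smul_eq_mul] using hxY y hy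
  rw [(mul_eq_zero.1 h0).resolve_right h, zero_smul]
  exact zero_mem _

theorem finrank_sup_inf_le_of_disjoint {K V : Type*} [DivisionRing K] [AddCommGroup V] [Module K V]
    [FiniteDimensional K V] {L Z W : Submodule K V} (h : Disjoint Z W) :
    Module.finrank K ((L ⊔ W) ⊓ Z : Submodule K V) ≤ Module.finrank K L := by
  have hdisj : (L ⊔ W) ⊓ Z ⊓ W = ⊥ := (h.mono_left inf_le_right).eq_bot
  have hle : (L ⊔ W) ⊓ Z ⊔ W ≤ L ⊔ W := sup_le inf_le_left le_sup_right
  have hsum := Submodule.finrank_sup_add_finrank_inf_eq ((L ⊔ W) ⊓ Z) W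
  rw [hdisj, finrank_bot, add_zero] at hsum
  have := hsum.symm.trans_le
    ((Submodule.finrank_mono hle).trans (Submodule.finrank_add_le_finrank_add_finrank L W))
  exact Nat.le_of_add_le_add_right this

section Lines

variable {τ : Type*}

/-- The line spanned by `(dʲ, 0, 0)`, `(0, dʲ, 0)` or `(0, 0, dʲ)`. -/
def powLine (d : τ → ℚ) (i : Fin 3) (j : ℕ) : Submodule ℚ (Fin 3 × τ → ℚ) :=
  Submodule.span ℚ {blockIncl i (d ^ j)}

/-- The line spanned by the vector `(1, -1, -1)`, each entry of which is a constant vector. -/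
def diagLine (τ : Type*) : Submodule ℚ (Fin 3 × τ → ℚ) :=
  Submodule.span ℚ {blockIncl 0 1 - blockIncl 1 1 - blockIncl 2 1}

theorem powLine_ne_bot [Nonempty τ] {d : τ → ℚ} (hd : ∀ t, 0 < d t) (i : Fin 3) (j : ℕ) :
    powLine d i j ≠ ⊥ := by
  refine Submodule.span_singleton_eq_bot.not.2 fun h => ?_
  have hzero : d ^ j = 0 := blockIncl_injective i (h.trans (map_zero _).symm)
  exact (pow_pos (hd _) j).ne' (congrFun hzero (Classical.arbitrary τ))

theorem diagLine_ne_bot [Nonempty τ] : diagLine τ ≠ ⊥ := by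
  refine Submodule.span_singleton_eq_bot.not.2 fun h => ?_
  simpa [blockIncl_apply] using congrFun h (0, Classical.arbitrary τ)

theorem finrank_powLine_le_one (d : τ → ℚ) (i : Fin 3) (j : ℕ) :
    Module.finrank ℚ (powLine d i j) ≤ 1 :=
  (finrank_span_le_card (R := ℚ) {blockIncl i (d ^ j)}).trans_eq (Set.toFinset_card _)

variable [Fintype τ] [DecidableEq τ]

theorem gramBlock_mulVec_one_pos {d : τ → ℚ} (hd : ∀ t, 0 < d t) (i : Fin 3) (t : τ) :
    0 < (gramBlock d i *ᵥ 1) t := by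
  fin_cases i
  · simp [gramBlock]
  · simpa [gramBlock, mulVec_diagonal] using hd t
  · have h : (gramBlock d 2 *ᵥ 1) t = 1 + Fintype.card τ := by
      simp [-vecMulVec_one, -one_vecMulVec, gramBlock, add_mulVec, vecMulVec_mulVec]
    exact h ▸ by positivity

theorem diagLine_inf_orthogonal_powLine [Nonempty τ] {d : τ → ℚ} (hd : ∀ t, 0 < d t) (i : Fin 3)
    (j : ℕ) : diagLine τ ⊓ (gramForm d hd).form.orthogonal (powLine d i j) = ⊥ := by
  refine (gramForm d hd).span_singleton_inf_orthogonal_eq_bot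
    (Submodule.mem_span_singleton_self _) ?_
  have hpos : 0 < d ^ j ⬝ᵥ gramBlock d i *ᵥ 1 := Finset.sum_pos
    (fun t _ => mul_pos (pow_pos (hd t) j) (gramBlock_mulVec_one_pos hd i t)) Finset.univ_nonempty
  rw [gramForm_blockIncl]
  fin_cases i <;>
    simpa [blockProj_blockIncl, mulVec_neg] using hpos.ne'

end Lines

variable {κ : Type*} {n : κ → ℕ} {d : ∀ k, Fin (n k) → ℚ} {U : Ultrafilter κ}
  (hpos : ∀ k t, 0 < d k t)

variable (U) in
/-- The map that sends a family of subspaces of the spaces `ℚ^(3·n k)` to the element of the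
ultraproduct of the ortholattices of subspaces that it represents. -/
def familyMk : BoundedLatticeHom (∀ k, SubspaceMOL (gramForm (d k) (hpos k)))
    ((U : Filter κ).Product fun k => SubspaceMOL (gramForm (d k) (hpos k))) :=
  reducedProductMk U fun k => SubspaceMOL (gramForm (d k) (hpos k))

theorem familyMk_eq_iff (X Y : ∀ k, Submodule ℚ (Fin 3 × Fin (n k) → ℚ)) :
    familyMk U hpos X = familyMk U hpos Y ↔ ∀ᶠ k in U, X k = Y k :=
  reducedProductMk_eq_iff

variable (U) in
/-- The subalgebra of the ultraproduct generated by the canonical 3-frames. -/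
def frameClosure :
    SubMOL ((U : Filter κ).Product fun k => SubspaceMOL (gramForm (d k) (hpos k))) :=
  SubMOL.closure
    (FrameData.product (U : Filter κ) fun k => canonicalFrame (gramForm (d k) (hpos k))).elems

variable (U) in
/-- The lattice of families that represent elements of `frameClosure U hpos`. -/
def frameFamilies : Sublattice (∀ k, Submodule ℚ (Fin 3 × Fin (n k) → ℚ)) :=
  (frameClosure U hpos).families (familyMk U hpos).toLatticeHom

theorem containsFrames_frameFamilies : ContainsFrames (frameFamilies U hpos) :=
  SubMOL.containsFrames_families (fun i => FrameData.pt_mem_closure _ i)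
    (fun _ _ hij => FrameData.ax_mem_closure _ hij)

theorem orthogonal_mem_frameFamilies {X : ∀ k, Submodule ℚ (Fin 3 × Fin (n k) → ℚ)}
    (hX : X ∈ frameFamilies U hpos) :
    (fun k => (gramForm (d k) (hpos k)).form.orthogonal (X k)) ∈ frameFamilies U hpos :=
  (frameClosure U hpos).compl_mem hX

theorem powLine_mem_frameFamilies (i : Fin 3) (j : ℕ) :
    (fun k => powLine (d k) i j) ∈ frameFamilies U hpos := by
  have hC := containsFrames_frameFamilies (U := U) hpos
  have hC' (X) (hX : X ∈ frameFamilies U hpos) := orthogonal_mem_frameFamilies hpos hX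
  have hr := mul_mem (pow_mem (hC.diagonal_mem_coordRing hC') j)
    (hC.vecMulVec_one_mem_coordRing hC')
  have hmul (k) : diagonal (d k) ^ j * vecMulVec 1 1 = vecMulVec (d k ^ j) 1 := by
    rw [diagonal_pow, mul_vecMulVec]
    congr 1
    ext t
    rw [mulVec_diagonal, Pi.one_apply, mul_one]
  have h := hC.imageSub_mem hr i
  simpa only [Pi.mul_apply, Pi.pow_apply, hmul, imageSub_vecMulVec_one] using! h

theorem diagLine_mem_frameFamilies : (fun k => diagLine (Fin (n k))) ∈ frameFamilies U hpos := by
  have hC := containsFrames_frameFamilies (U := U) hpos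
  have hw : (fun k => Submodule.span ℚ {blockIncl 0 (1 : Fin (n k) → ℚ)}) ∈
      frameFamilies U hpos := by
    simpa only [powLine, pow_zero] using powLine_mem_frameFamilies hpos 0 0
  have h := hC.span_singleton_mem (i := 0) (j := 1) (l := 2) (by decide) (by decide) (by decide)
    (one_mem _) (one_mem _) hw
  simpa only [Pi.one_apply, one_mulVec] using! h

theorem exists_isSandwiched_of_mem_frameClosure (hd : TendsToInfinity U d)
    {x : (U : Filter κ).Product fun k => SubspaceMOL (gramForm (d k) (hpos k))}
    (hx : x ∈ (frameClosure U hpos).carrier) :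
    ∃ X, IsSandwiched U d X ∧ familyMk U hpos X = x := by
  refine hx (.ofSupCompl (familyMk U hpos '' {X | IsSandwiched U d X})
    ⟨_, isSandwiched_bot, rfl⟩ ?_ ?_) ?_
  · rintro _ _ ⟨X, hX, rfl⟩ ⟨Y, hY, rfl⟩
    exact ⟨_, hd.isSandwiched_sup hX hY, rfl⟩
  · rintro _ ⟨X, hX, rfl⟩
    exact ⟨_, hd.isSandwiched_orthogonal_gramForm hpos hX, rfl⟩
  · rintro _ (⟨i, rfl⟩ | ⟨i, j, -, rfl⟩)
    · refine ⟨fun _ => axisSub i, ?_, congrArg _ (funext fun k => (canonicalFrame_pt _ i).symm)⟩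
      simpa only [zero_smul, graphSub_zero] using!
        isSandwiched_graphSub_smul_one (l := (U : Filter κ)) (d := d) i 0 0
    · refine ⟨fun _ => graphSub i j 1, ?_,
        congrArg _ (funext fun k => (canonicalFrame_ax _ i j).symm)⟩
      simpa only [one_smul] using!
        isSandwiched_graphSub_smul_one (l := (U : Filter κ)) (d := d) i j 1

variable (hd : TendsToInfinity U d) (hinj : ∀ k, Function.Injective (d k)) (hn : Tendsto n U atTop)

include hd hinj hn

theorem exists_powLine_inf_compl_eq_bot
    {z : (U : Filter κ).Product fun k => SubspaceMOL (gramForm (d k) (hpos k))}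
    (hz : z ∈ (frameClosure U hpos).carrier) (hz0 : z ≠ ⊥) :
    ∃ i j, familyMk U hpos (fun k => powLine (d k) i j) ⊓ zᶜ = ⊥ := by
  obtain ⟨X, hX, rfl⟩ := exists_isSandwiched_of_mem_frameClosure hpos hd hz
  by_contra! hcon
  refine hz0 ((familyMk_eq_iff hpos X fun _ => ⊥).2 (hX.eventually_eq_bot (hpos := hpos) hd hinj
    (by simpa only [Fintype.card_fin] using hn) fun i j => ?_))
  have h : ∀ᶠ k in U, ¬powLine (d k) i j ⊓ (gramForm (d k) (hpos k)).form.orthogonal (X k) = ⊥ :=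
    Ultrafilter.eventually_not.2 fun h => hcon i j
      ((familyMk_eq_iff hpos (fun k => _ ⊓ (gramForm (d k) (hpos k)).form.orthogonal _)
        fun _ => ⊥).2 h)
  filter_upwards [h] with k hk x hx
  by_contra hne
  rw [(gramForm (d k) (hpos k)).symm] at hne
  exact hk ((gramForm (d k) (hpos k)).span_singleton_inf_orthogonal_eq_bot hx hne)

theorem isSubdirectlyIrreducibleMOL_frameClosure :
    IsSubdirectlyIrreducibleMOL (frameClosure U hpos).Elem := by
  have hne : ∀ᶠ k in U, Nonempty (Fin (n k)) := by
    filter_upwards [hn.eventually_gt_atTop 0] with k hk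
    exact Fin.pos_iff_nonempty.1 hk
  refine isSubdirectlyIrreducibleMOL_of_inf_compl
    (p := ⟨familyMk U hpos _, diagLine_mem_frameFamilies hpos⟩) (fun h => ?_) ?_
  · have h' := (familyMk_eq_iff hpos _ fun _ => ⊥).1 (congrArg Subtype.val h)
    obtain ⟨k, hk, _⟩ := (h'.and hne).exists
    exact diagLine_ne_bot hk
  · rintro ⟨z, hz⟩ hz0
    obtain ⟨i, j, h⟩ := exists_powLine_inf_compl_eq_bot hpos hd hinj hn hz
      fun h => hz0 (Subtype.ext h)
    refine ⟨⟨_, powLine_mem_frameFamilies hpos i j⟩, Subtype.ext h,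
      Subtype.ext ((familyMk_eq_iff hpos (fun k => diagLine _ ⊓
        (gramForm (d k) (hpos k)).form.orthogonal (powLine (d k) i j)) fun _ => ⊥).2 ?_)⟩
    filter_upwards [hne] with k _
    exact diagLine_inf_orthogonal_powLine (hpos k) i j

theorem latticeHeight_frameClosure : latticeHeight (frameClosure U hpos).Elem = ⊤ := by
  refine latticeHeight_eq_top_of_forall_exists_le
    (fun x => ∃ (N : ℕ) (X : ∀ k, Submodule ℚ (Fin 3 × Fin (n k) → ℚ)),
      familyMk U hpos X = x.1 ∧ ∀ᶠ k in U, Module.finrank ℚ (X k) ≤ N) ?_ ?_ ?_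
  · exact ⟨0, fun _ => ⊥, rfl, Eventually.of_forall fun k => (finrank_bot ℚ _).le⟩
  · rintro ⟨N, X, hX, hN⟩
    obtain ⟨k, ⟨hk, hkN⟩, hlt⟩ := ((((familyMk_eq_iff hpos X fun _ => ⊤).1 hX).and hN).and
      (hn.eventually_gt_atTop N)).exists
    rw [hk, finrank_top, Module.finrank_fintype_fun_eq_card, Fintype.card_prod,
      Fintype.card_fin, Fintype.card_fin] at hkN
    omega
  · rintro ⟨z, hz⟩ hz0
    obtain ⟨i, j, h⟩ := exists_powLine_inf_compl_eq_bot hpos hd hinj hn hz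
      fun h => hz0 (Subtype.ext h)
    let S := frameClosure U hpos
    let q : S.Elem := ⟨familyMk U hpos _, powLine_mem_frameFamilies hpos i j⟩
    have hq : q ≠ ⊥ := fun hq => by
      have hq' := (familyMk_eq_iff hpos _ fun _ => ⊥).1 (congrArg Subtype.val hq)
      obtain ⟨k, hk, hlt⟩ := (hq'.and (hn.eventually_gt_atTop 0)).exists
      have := Fin.pos_iff_nonempty.1 hlt
      exact powLine_ne_bot (hpos k) i j hk
    refine ⟨(q ⊔ ⟨z, hz⟩ᶜ) ⊓ ⟨z, hz⟩, inf_le_right,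
      ModularOrtholattice.sup_compl_inf_ne_bot hq (Subtype.ext h), ?_⟩
    obtain ⟨Z, -, rfl⟩ := exists_isSandwiched_of_mem_frameClosure hpos hd hz
    rintro ⟨_, hb⟩ ⟨N, X, rfl, hN⟩
    refine ⟨N + 1, fun k => X k ⊔ (powLine (d k) i j ⊔
      (gramForm (d k) (hpos k)).form.orthogonal (Z k)) ⊓ Z k, rfl, ?_⟩
    filter_upwards [hN] with k hk
    exact (Submodule.finrank_add_le_finrank_add_finrank _ _).trans (add_le_add hk
      ((finrank_sup_inf_le_of_disjoint ((gramForm (d k) (hpos k)).isCompl _).disjoint).trans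
        (finrank_powLine_le_one (d k) i j)))

end Ultraproduct

open Filter in
theorem corollary4p16_general {κ : Type*} (n : κ → ℕ) :
    ∃ Φ : ∀ k, PosDefForm (Fin 3 × Fin (n k)),
      (∀ k, (canonicalFrame (Φ k)).IsGeneratingOrthogonalFrame) ∧
      ∀ U : Ultrafilter κ, Tendsto n U atTop →
        ∃ S : SubMOL ((U : Filter κ).Product fun k => SubspaceMOL (Φ k)),
          IsSubdirectlyIrreducibleMOL S.Elem ∧
          latticeHeight S.Elem = ⊤ ∧
          ∃ a : FrameData 3 S.Elem,
            a.IsGeneratingOrthogonalFrame ∧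
            (∀ i, (a.pt i).1 =
              (FrameData.product (U : Filter κ) fun k => canonicalFrame (Φ k)).pt i) ∧
            (∀ i j, i ≠ j → (a.ax i j).1 =
              (FrameData.product (U : Filter κ) fun k => canonicalFrame (Φ k)).ax i j) := by
  let d (k) (t : Fin (n k)) : ℚ := n k + t + 1
  have hpos (k t) : 0 < d k t := by positivity
  have hinj (k) : Function.Injective (d k) := fun s t h => by simpa [d, Fin.ext_iff] using h
  have hframe (k) : (canonicalFrame (gramForm (d k) (hpos k))).IsGeneratingOrthogonalFrame :=
    isGeneratingOrthogonalFrame_canonicalFrame (hpos k) (hinj k)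
  refine ⟨fun k => gramForm (d k) (hpos k), hframe, fun U hU => ?_⟩
  have hd : TendsToInfinity U d := fun a => by
    filter_upwards [(tendsto_natCast_atTop_atTop.comp hU).eventually_ge_atTop a] with k hk t
    exact hk.trans (by dsimp [d]; linarith [t.1.cast_nonneg (α := ℚ)])
  exact ⟨frameClosure U hpos, isSubdirectlyIrreducibleMOL_frameClosure hpos hd hinj hU,
    latticeHeight_frameClosure hpos hd hinj hU, (FrameData.product (U : Filter κ) _).inClosure,
    FrameData.isGeneratingOrthogonalFrame_inClosure
      (FrameData.IsFrame.product _ fun k => (hframe k).1)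
      (FrameData.IsOrthogonal.product _ fun k => (hframe k).2.1),
    fun _ => rfl, fun i j hij => congrArg Subtype.val (FrameData.inClosure_ax _ hij)⟩

theorem corollary4p16 :
    ∃ Φ : ∀ k : ℕ, PosDefForm (Fin 3 × Fin (2 ^ k)),
      (∀ k : ℕ, (canonicalFrame (Φ k)).IsGeneratingOrthogonalFrame) ∧
      ∀ U : Ultrafilter ℕ, (∀ k : ℕ, U ≠ pure k) →
        ∃ S : SubMOL ((U : Filter ℕ).Product fun k => SubspaceMOL (Φ k)),
          IsSubdirectlyIrreducibleMOL S.Elem ∧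
          latticeHeight S.Elem = ⊤ ∧
          ∃ a : FrameData 3 S.Elem,
            a.IsGeneratingOrthogonalFrame ∧
            (∀ i, (a.pt i).1 =
              (FrameData.product (U : Filter ℕ) fun k => canonicalFrame (Φ k)).pt i) ∧
            (∀ i j, i ≠ j → (a.ax i j).1 =
              (FrameData.product (U : Filter ℕ) fun k => canonicalFrame (Φ k)).ax i j) := by
  obtain ⟨Φ, hΦ, h⟩ := corollary4p16_general fun k => 2 ^ k
  refine ⟨Φ, hΦ, fun U hU => h U ((tendsto_pow_atTop_atTop_of_one_lt one_lt_two).mono_left ?_)⟩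
  exact (U.le_cofinite_or_eq_pure.resolve_right fun ⟨k, hk⟩ => hU k hk).trans_eq
    Nat.cofinite_eq_atTop
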